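/- **Setting.** Let $(\Theta,d\theta)$ be a measure space, $\Lambda$ a set, $\lambda_1,\dots,\lambda_L\in\Lambda$ ($L\ge 1$) grid points, and let $\psi_l:\Theta\to[0,\infty)$, $l\in\Lambda$, be measurable and integrable with $z(l)=\int\psi_l(\theta)\,d\theta>0$. Let $p$ be a real function on $\Lambda$ (the prior density), positive at the grid points and at the point $\lambda\in\Lambda$ considered below, and put $\pi_l=\psi_l/z(l)$, $$\rho_l(\theta)=\frac{\psi_l(\theta)p(l)}{\sum_{m=1}^L\psi_{\lambda_m}(\theta)p(\lambda_m)},\qquad u(l)=\frac{L\,z(l)p(l)}{\sum_{m=1}^L z(\lambda_m)p(\lambda_m)},\qquad u_i=u(\lambda_i),$$ $$F_{ij}=\int\rho_{\lambda_j}(\theta)\,\pi_{\lambda_i}(\theta)\,d\theta,\qquad R_{ij}=\operatorname{Var}_{\pi_{\lambda_i}}(\rho_{\lambda_j}),\qquad r_i(l)=\operatorname{Var}_{\pi_{\lambda_i}}(\rho_l)\in[0,\infty].$$ Let $Q_{ij}$ be the probability that the Markov chain on $\{1,\dots,L\}$ with transition matrix $F$ started at $i$ visits $j$ before returning to $i$.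 For independent samples $\theta_i^{(n)}\sim\pi_{\lambda_i}$ ($1\le i\le L$, $n\ge 1$) and sample sizes $N_1,\dots,N_L$ with $N=\sum_i N_i$, put $$\widehat f(\lambda_i,l)=\frac1{N_i}\sum_{n=1}^{N_i}\rho_l(\theta_i^{(n)}),\qquad \widehat F_{ij}=\widehat f(\lambda_i,\lambda_j),\qquad \widehat u(l)=\sum_{i=1}^L\widehat u_i\,\widehat f(\lambda_i,l),$$ where $\widehat{\boldsymbol u}=(\widehat u_1,\dots,\widehat u_L)$ is any random vector with $\widehat{\boldsymbol u}=\widehat F^{\mathsf T}\widehat{\boldsymbol u}$ and $\sum_i\widehat u_i=L$ almost surely. **Proposition.** Let $\lambda\in\Lambda$ be a point with $p(\lambda)>0$. Assume that * $\sum_m\psi_{\lambda_m}(\theta)p(\lambda_m)>0$ for almost every $\theta$ with $\psi_\lambda(\theta)>0$ (automatic if all $\psi_l$ are strictly positive), * $F$ is irreducible, * $w_i>0$ for all $i$, * $r_i(\lambda)<\infty$ for all $i$. Then there is $\sigma^2(\lambda)\ge 0$, not depending on the samples or on the particular sequence of sample sizes, such that whenever $N\to\infty$ with $N_i/N\to w_i$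 for all $i$, $$\sqrt N\,\bigl(\widehat u(\lambda)-u(\lambda)\bigr)\ \longrightarrow\ \mathcal N\bigl(0,\sigma^2(\lambda)\bigr)\quad\text{in distribution},$$ where a Gaussian of variance $0$ is the point mass at $0$, and $$\frac{\sigma^2(\lambda)}{u^2(\lambda)}\ \le\ 2\sum_{i=1}^L w_i^{-1}\Bigl(L\sum_{j\ne i}\frac{R_{ij}}{Q_{ij}^2}+\frac{u_i^2}{u^2(\lambda)}\,r_i(\lambda)\Bigr).$$ -/

import Mathlib

open MeasureTheory ProbabilityTheory Filter Topology
open scoped ENNReal NNReal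

namespace Emus

/-! ### The model

`Θ` is the sample space with reference measure `μ` (written `dθ`), `ψ l θ` is the unnormalised density
at the hyperparameter `l : Λ`, `p l` is the prior density, and `grid i` is the `i`-th grid point. -/

section Model

variable {Θ : Type*} [MeasurableSpace Θ] {Λ : Type*} {L : ℕ}

/-- The normalising constant `z(l) = ∫ ψ_l(θ) dθ`. -/
noncomputable def z (μ : Measure Θ) (ψ : Λ → Θ → ℝ) (l : Λ) : ℝ :=
  ∫ θ, ψ l θ ∂μ

/-- The probability distribution on `Θ` with density `π_l(θ) = ψ_l(θ) / z(l)`. -/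
noncomputable def localLaw (μ : Measure Θ) (ψ : Λ → Θ → ℝ) (l : Λ) : Measure Θ :=
  μ.withDensity fun θ => ENNReal.ofReal (ψ l θ / z μ ψ l)

/-- The function `u(l) ∝ z(l) p(l)`, normalised so that its values on the grid sum to `L`. -/
noncomputable def u (μ : Measure Θ) (ψ : Λ → Θ → ℝ) (p : Λ → ℝ) (grid : Fin L → Λ) (l : Λ) : ℝ :=
  L * (z μ ψ l * p l) / ∑ i, z μ ψ (grid i) * p (grid i)

/-- The mixture `∑_ℓ ψ_{λ_ℓ}(θ) p(λ_ℓ)` over the grid. -/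
noncomputable def mixture (ψ : Λ → Θ → ℝ) (p : Λ → ℝ) (grid : Fin L → Λ) (θ : Θ) : ℝ :=
  ∑ i, ψ (grid i) θ * p (grid i)

/-- The ratio `ψ_l(θ) p(l) / ∑_ℓ ψ_{λ_ℓ}(θ) p(λ_ℓ)`. -/
noncomputable def ratio (ψ : Λ → Θ → ℝ) (p : Λ → ℝ) (grid : Fin L → Λ) (l : Λ) (θ : Θ) : ℝ :=
  ψ l θ * p l / mixture ψ p grid θ

/-- The matrix `F i j = ∫ ψ_{λ_j}(θ) p(λ_j) / (∑_ℓ ψ_{λ_ℓ}(θ) p(λ_ℓ)) π_{λ_i}(θ) dθ`. -/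
noncomputable def F (μ : Measure Θ) (ψ : Λ → Θ → ℝ) (p : Λ → ℝ) (grid : Fin L → Λ) :
    Matrix (Fin L) (Fin L) ℝ :=
  Matrix.of fun i j => ∫ θ, ratio ψ p grid (grid j) θ * (ψ (grid i) θ / z μ ψ (grid i)) ∂μ

/-- `r_i(l)`: the (possibly infinite) variance of the ratio at `l` under `π_{λ_i}`. -/
noncomputable def r (μ : Measure Θ) (ψ : Λ → Θ → ℝ) (p : Λ → ℝ) (grid : Fin L → Λ)
    (i : Fin L) (l : Λ) : ℝ≥0∞ :=
  evariance (ratio ψ p grid l) (localLaw μ ψ (grid i))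

/-- `R i j`: the variance of the ratio at `λ_j` under `π_{λ_i}`. -/
noncomputable def R (μ : Measure Θ) (ψ : Λ → Θ → ℝ) (p : Λ → ℝ) (grid : Fin L → Λ) :
    Matrix (Fin L) (Fin L) ℝ :=
  Matrix.of fun i j => variance (ratio ψ p grid (grid j)) (localLaw μ ψ (grid i))

/-! ### The estimators

`N i` is the number of samples used at grid point `i`, and `x i n` is the `n`-th sample there. -/

/-- `f̂(λ_i, l) = N_i⁻¹ ∑_{n < N_i} ψ_l(x_i^n) p(l) / ∑_ℓ ψ_{λ_ℓ}(x_i^n) p(λ_ℓ)`. -/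
noncomputable def fHat (ψ : Λ → Θ → ℝ) (p : Λ → ℝ) (grid : Fin L → Λ)
    (N : Fin L → ℕ) (x : Fin L → ℕ → Θ) (i : Fin L) (l : Λ) : ℝ :=
  (1 / (N i : ℝ)) * ∑ n ∈ Finset.range (N i), ratio ψ p grid l (x i n)

/-- The estimated matrix `F̂ i j = f̂(λ_i, λ_j)`. -/
noncomputable def FHat (ψ : Λ → Θ → ℝ) (p : Λ → ℝ) (grid : Fin L → Λ)
    (N : Fin L → ℕ) (x : Fin L → ℕ → Θ) : Matrix (Fin L) (Fin L) ℝ :=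
  Matrix.of fun i j => fHat ψ p grid N x i (grid j)

/-- `v` solves the EMUS eigenproblem `v = F̂ᵀ v`, normalised by `∑ v = L`. -/
def IsEmusSolution (ψ : Λ → Θ → ℝ) (p : Λ → ℝ) (grid : Fin L → Λ)
    (N : Fin L → ℕ) (x : Fin L → ℕ → Θ) (v : Fin L → ℝ) : Prop :=
  v = (FHat ψ p grid N x).transpose.mulVec v ∧ ∑ i, v i = L

/-- The functional estimator `û(l) = ∑_ℓ v_ℓ f̂(λ_ℓ, l)`. -/
noncomputable def uHat (ψ : Λ → Θ → ℝ) (p : Λ → ℝ) (grid : Fin L → Λ)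
    (N : Fin L → ℕ) (x : Fin L → ℕ → Θ) (v : Fin L → ℝ) (l : Λ) : ℝ :=
  ∑ i, v i * fHat ψ p grid N x i l

end Model

/-! ### Visit probabilities of a finite Markov chain -/

section Chain

variable {L : ℕ}

open Classical in
/-- The one-step distribution from state `i` for the transition matrix `A`. If row `i` of `A` is not
a probability vector, the chain stays at `i`, so that the chain is defined for every `A`. -/
noncomputable def stepMeasure (A : Matrix (Fin L) (Fin L) ℝ) (i : Fin L) : Measure (Fin L) :=
  if (∀ j, 0 ≤ A i j) ∧ ∑ j, A i j = 1 then
    ∑ j, ENNReal.ofReal (A i j) • Measure.dirac j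
  else Measure.dirac i

instance instIsProbabilityMeasureStepMeasure (A : Matrix (Fin L) (Fin L) ℝ) (i : Fin L) :
    IsProbabilityMeasure (stepMeasure A i) := by
  unfold stepMeasure
  split_ifs with h
  · constructor
    simp only [Measure.coe_finsetSum, Measure.coe_smul, Finset.sum_apply, Pi.smul_apply,
      measure_univ, smul_eq_mul, mul_one]
    rw [← ENNReal.ofReal_sum_of_nonneg (fun j _ => h.1 j), h.2, ENNReal.ofReal_one]
  · infer_instance

/-- The Markov kernel of the transition matrix `A`. -/
noncomputable def stepKernel (A : Matrix (Fin L) (Fin L) ℝ) : Kernel (Fin L) (Fin L) where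
  toFun := stepMeasure A
  measurable' := measurable_of_countable _

instance instIsMarkovKernelStepKernel (A : Matrix (Fin L) (Fin L) ℝ) :
    IsMarkovKernel (stepKernel A) :=
  ⟨fun i => instIsProbabilityMeasureStepMeasure A i⟩

/-- The law of a Markov chain `X₀, X₁, …` with transition matrix `A` started at `X₀ = i`. -/
noncomputable def chainLaw (A : Matrix (Fin L) (Fin L) ℝ) (i : Fin L) : Measure (ℕ → Fin L) :=
  Kernel.trajMeasure (X := fun _ => Fin L) (Measure.dirac i) fun n =>
    (stepKernel A).comap (fun h : (Π _ : Finset.Iic n, Fin L) => h ⟨n, by simp⟩)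
      (measurable_pi_apply _)

/-- `visitProb A i j`: the probability that the chain with transition matrix `A` started at `i`
visits `j` before returning to `i`. -/
noncomputable def visitProb (A : Matrix (Fin L) (Fin L) ℝ) (i j : Fin L) : ℝ :=
  (chainLaw A i).real {X | ∃ n, 1 ≤ n ∧ X n = j ∧ ∀ m, 1 ≤ m → m < n → X m ≠ i}

end Chain

end Emus

/-! Write `f i` for the mean of `ρ_l` under `π_i`. Averaging gives `∑ u_i f_i = u(l)`, and the same
identity at grid points says that `u` is stationary for `F`. Let `h` solve Poisson's equation `h - F
h = f - c` with `c = u(l) / L`, and put `g = ρ_l + ∑_j h_j ρ_{λ_j}`. Since the estimate is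
stationary for `F̂`, the error equals exactly `∑ û_i (ḡ_i - E_{π_i} g)`, where `ḡ_i` is a sample
mean of `g` (`uHat_sub_eq`). No linearisation is needed: the strong law makes `F̂` converge to `F`,
hence `û` to `u` (`tendsto_stationary`), and the central limit theorem with Slutsky's lemma gives
the limit variance `∑ u_i² / w_i · Var_{π_i} g`.

For the bound, the grid ratios sum to one, so only the increments `h_j - h_i` enter `Var_{π_i} g`.
They satisfy `u_i |h_j - h_i| Q_ij ≤ u(l)` (`IsCommittor.mul_abs_sub_le`). As `c ≥ 0`, an increment
is at most the expected reward `f` collected until a hitting time. Stationarity bounds the reward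
from `j` until reaching `i`; time reversal bounds the one from `i` until reaching `j`. Finally
`visitProb_eq` identifies `Q_ij` with the value at `i` of `F` applied to a committor. -/

namespace Matrix

/-! ### Potential theory of an irreducible stochastic matrix. -/

variable {ι : Type*} [Fintype ι] {A : Matrix ι ι ℝ}

lemma mulVec_sub_const_of_row_sum (hrow : ∀ i, ∑ j, A i j = 1) (a : ι → ℝ) (c : ℝ) (i : ι) :
    (A *ᵥ fun j => a j - c) i = (A *ᵥ a) i - c := by
  simp only [mulVec, dotProduct, mul_sub, Finset.sum_sub_distrib, ← Finset.sum_mul, hrow, one_mul]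

lemma sum_mul_sub_mulVec_of_stationary {v : ι → ℝ} (hv : v ᵥ* A = v) (a : ι → ℝ) :
    ∑ i, v i * (a i - (A *ᵥ a) i) = 0 := by
  have h : v ⬝ᵥ (A *ᵥ a) = v ⬝ᵥ a := by rw [dotProduct_mulVec, hv]
  simp only [mul_sub, Finset.sum_sub_distrib]
  exact sub_eq_zero.2 h.symm

/-- **Minimum principle** for an irreducible stochastic matrix. -/
lemma IsIrreducible.nonneg_of_superharmonic (hA : A.IsIrreducible)
    (hrow : ∀ i, ∑ j, A i j = 1) {B : ι → Prop} {b : ι} (hb : B b) {d : ι → ℝ}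
    (hd : ∀ i, ¬ B i → (A *ᵥ d) i ≤ d i) (hdB : ∀ i, B i → 0 ≤ d i) (i : ι) : 0 ≤ d i := by
  classical
  obtain ⟨m, -, hm⟩ := Finset.exists_min_image Finset.univ d ⟨b, Finset.mem_univ b⟩
  by_contra! hi
  have hm_neg : d m < 0 := (hm i (Finset.mem_univ i)).trans_lt hi
  -- At a minimiser outside `B` the average of `d` cannot exceed the minimum, so every successor of
  -- positive weight is a minimiser too.
  have step : ∀ x y, d x = d m → 0 < A x y → d y = d m := by
    intro x y hx hxy
    have hxB : ¬ B x := fun h => by linarith [hdB x h]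
    have h0 : ∑ j, A x j * (d j - d m) = 0 := by
      apply le_antisymm
      · have := hd x hxB
        simp only [mulVec, dotProduct] at this
        simp only [mul_sub, Finset.sum_sub_distrib, ← Finset.sum_mul, hrow]
        linarith
      · exact Finset.sum_nonneg fun j _ =>
          mul_nonneg (hA.nonneg x j) (sub_nonneg.2 (hm j (Finset.mem_univ j)))
    have := (Finset.sum_eq_zero_iff_of_nonneg fun j _ =>
      mul_nonneg (hA.nonneg x j) (sub_nonneg.2 (hm j (Finset.mem_univ j)))).1 h0 y
        (Finset.mem_univ y)
    rcases mul_eq_zero.1 this with h | h <;> linarith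
  have reach : ∀ k y, 0 < (A ^ k) m y → d y = d m := by
    intro k
    induction k with
    | zero =>
      intro y hy
      rcases eq_or_ne m y with rfl | hne
      · rfl
      · simp [one_apply_ne hne] at hy
    | succ k ih =>
      intro y hy
      rw [pow_succ, mul_apply] at hy
      obtain ⟨x, -, hx⟩ := Finset.exists_lt_of_sum_lt (s := Finset.univ)
        (f := fun _ => (0 : ℝ)) (by simpa using hy)
      have h1 : 0 ≤ (A ^ k) m x := pow_apply_nonneg hA.nonneg k m x
      have h2 := hA.nonneg x y
      have h1' : 0 < (A ^ k) m x := lt_of_le_of_ne h1 fun h => by simp [← h] at hx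
      have h2' : 0 < A x y := lt_of_le_of_ne h2 fun h => by simp [← h] at hx
      exact step x y (ih x h1') h2'
  obtain ⟨k, -, hk⟩ := (isIrreducible_iff_exists_pow_pos hA.nonneg).1 hA m b
  linarith [reach k b hk, hdB b hb]

lemma IsIrreducible.eq_zero_of_harmonic (hA : A.IsIrreducible)
    (hrow : ∀ i, ∑ j, A i j = 1) {B : ι → Prop} {b : ι} (hb : B b) {d : ι → ℝ}
    (hd : ∀ i, ¬ B i → d i - (A *ᵥ d) i = 0) (hdB : ∀ i, B i → d i = 0) : d = 0 := by
  funext i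
  apply le_antisymm
  · have := hA.nonneg_of_superharmonic hrow hb (d := -d)
      (fun j hj => by rw [mulVec_neg]; simp only [Pi.neg_apply]; linarith [hd j hj])
      (fun j hj => by simp [hdB j hj]) i
    simpa using this
  · exact hA.nonneg_of_superharmonic hrow hb (fun j hj => by linarith [hd j hj])
      (fun j hj => (hdB j hj).ge) i

/-- Solvability of the Dirichlet problem for an irreducible stochastic matrix. -/
lemma IsIrreducible.exists_dirichlet (hA : A.IsIrreducible)
    (hrow : ∀ i, ∑ j, A i j = 1) (B : ι → Prop) {b : ι} (hb : B b) (g : ι → ℝ) :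
    ∃ a : ι → ℝ, (∀ i, B i → a i = g i) ∧ ∀ i, ¬ B i → a i - (A *ᵥ a) i = g i := by
  classical
  -- Identity on the rows in `B`, `I - A` on the others; uniqueness makes it injective, hence
  -- surjective in finite dimension.
  let T : (ι → ℝ) →ₗ[ℝ] ι → ℝ :=
    { toFun := fun a i => a i - if B i then 0 else (A *ᵥ a) i
      map_add' := fun a a' => by
        funext i
        simp only [mulVec_add, Pi.add_apply]
        split_ifs <;> ring
      map_smul' := fun c a => by
        funext i
        simp only [mulVec_smul, Pi.smul_apply, smul_eq_mul, RingHom.id_apply]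
        split_ifs <;> ring }
  have hT : Function.Injective T := by
    rw [← LinearMap.ker_eq_bot, LinearMap.ker_eq_bot']
    intro a ha
    refine hA.eq_zero_of_harmonic hrow hb (fun i hi => ?_) fun i hi => ?_
    · simpa [T, hi] using congrFun ha i
    · simpa [T, hi] using congrFun ha i
  obtain ⟨a, ha⟩ := LinearMap.injective_iff_surjective.1 hT g
  exact ⟨a, fun i hi => by simpa [T, hi] using congrFun ha i,
    fun i hi => by simpa [T, hi] using congrFun ha i⟩

/-- `q` is the probability of hitting `j` before `i`, as a function of the starting point. -/
structure IsCommittor (A : Matrix ι ι ℝ) (i j : ι) (q : ι → ℝ) : Prop where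
  source : q i = 0
  target : q j = 1
  harmonic : ∀ x, x ≠ i → x ≠ j → (A *ᵥ q) x = q x

lemma IsIrreducible.exists_isCommittor (hA : A.IsIrreducible)
    (hrow : ∀ i, ∑ j, A i j = 1) {i j : ι} (hij : j ≠ i) : ∃ q, IsCommittor A i j q := by
  classical
  obtain ⟨q, hqB, hq⟩ := hA.exists_dirichlet hrow (fun x => x = i ∨ x = j) (Or.inl rfl)
    (Pi.single j 1)
  refine ⟨q, ?_, ?_, fun x hxi hxj => ?_⟩
  · simpa [hij.symm] using hqB i (Or.inl rfl)
  · simpa using hqB j (Or.inr rfl)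
  · have := hq x (by tauto)
    rw [Pi.single_eq_of_ne hxj] at this
    linarith

lemma IsCommittor.nonneg {i j : ι} {q : ι → ℝ} (hq : IsCommittor A i j q) (hA : A.IsIrreducible)
    (hrow : ∀ i, ∑ j, A i j = 1) (x : ι) : 0 ≤ q x := by
  refine hA.nonneg_of_superharmonic hrow (B := fun x => x = i ∨ x = j) (Or.inl rfl)
    (fun x hx => ?_) (fun x hx => ?_) x
  · rw [not_or] at hx
    exact (hq.harmonic x hx.1 hx.2).le
  · rcases hx with rfl | rfl
    · exact hq.source.ge
    · rw [hq.target]; exact zero_le_one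

/-- Exchanging the two endpoints of a committor. -/
lemma IsCommittor.symm {i j : ι} {q : ι → ℝ} (hq : IsCommittor A i j q)
    (hrow : ∀ i, ∑ j, A i j = 1) : IsCommittor A j i fun x => 1 - q x := by
  refine ⟨by simp [hq.target], by simp [hq.source], fun x hxj hxi => ?_⟩
  have h : (fun x => 1 - q x) = -fun x => q x - 1 := by funext x; simp
  rw [h, mulVec_neg, Pi.neg_apply, mulVec_sub_const_of_row_sum hrow, hq.harmonic x hxi hxj]
  ring

/-- If the value were zero, `q` would be harmonic at `i` as well, so `q - 1` would vanish
identically, against `q i = 0`. -/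
lemma IsCommittor.pos {i j : ι} {q : ι → ℝ} (hq : IsCommittor A i j q) (hA : A.IsIrreducible)
    (hrow : ∀ i, ∑ j, A i j = 1) : 0 < (A *ᵥ q) i := by
  have h0 : 0 ≤ (A *ᵥ q) i :=
    Finset.sum_nonneg fun x _ => mul_nonneg (hA.nonneg i x) (hq.nonneg hA hrow x)
  refine lt_of_le_of_ne h0 fun h => ?_
  have := hA.eq_zero_of_harmonic hrow (B := fun x => x = j) (b := j) rfl (d := fun x => q x - 1)
    (fun x hx => ?_) (fun x hx => by simp [hx, hq.target])
  · have := congrFun this i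
    simp [hq.source] at this
  · rw [mulVec_sub_const_of_row_sum hrow]
    rcases eq_or_ne x i with rfl | hxi
    · rw [← h, hq.source]; ring
    · rw [hq.harmonic x hxi hx]; ring

/-- The time reversal of `A` with respect to the weights `v`. -/
noncomputable def reversal (A : Matrix ι ι ℝ) (v : ι → ℝ) : Matrix ι ι ℝ :=
  of fun x y => v y * A y x / v x

lemma reversal_row_sum {v : ι → ℝ} (hv0 : ∀ i, 0 < v i) (hv : v ᵥ* A = v) (i : ι) :
    ∑ j, A.reversal v i j = 1 := by
  have : ∑ j, v j * A j i = v i := congrFun hv i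
  simp only [reversal, of_apply, ← Finset.sum_div, this, div_self (hv0 i).ne']

lemma IsIrreducible.reversal (hA : A.IsIrreducible) {v : ι → ℝ} (hv0 : ∀ i, 0 < v i) :
    (A.reversal v).IsIrreducible := by
  classical
  have hnn : ∀ x y, 0 ≤ A.reversal v x y := fun x y =>
    div_nonneg (mul_nonneg (hv0 y).le (hA.nonneg y x)) (hv0 x).le
  rw [isIrreducible_iff_exists_pow_pos hnn]
  -- Powers of the reversal are reversals of powers, so positive paths are simply run backwards.
  have hpow : ∀ k x y, (A.reversal v ^ k) x y = v y * (A ^ k) y x / v x := by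
    intro k
    induction k with
    | zero =>
      intro x y
      rcases eq_or_ne x y with rfl | h
      · simp [(hv0 x).ne']
      · simp [one_apply_ne h, one_apply_ne h.symm]
    | succ k ih =>
      intro x y
      rw [pow_succ', pow_succ, mul_apply, mul_apply, Finset.mul_sum, Finset.sum_div]
      refine Finset.sum_congr rfl fun t _ => ?_
      rw [ih, Matrix.reversal, of_apply]
      have := (hv0 t).ne'
      have := (hv0 x).ne'
      field_simp
  intro x y
  obtain ⟨k, hk, h⟩ := (isIrreducible_iff_exists_pow_pos hA.nonneg).1 hA y x
  exact ⟨k, hk, by rw [hpow]; exact div_pos (mul_pos (hv0 y) h) (hv0 x)⟩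

/-- Green's identity: the reversal is the adjoint of `A` for the inner product weighted by `v`. -/
lemma sum_mul_sub_reversal_mulVec {v : ι → ℝ} (hv0 : ∀ i, 0 < v i) (a b : ι → ℝ) :
    ∑ x, v x * b x * (a x - (A *ᵥ a) x) = ∑ x, v x * a x * (b x - (A.reversal v *ᵥ b) x) := by
  have h : ∑ x, v x * b x * (A *ᵥ a) x = ∑ x, v x * a x * (A.reversal v *ᵥ b) x := by
    simp only [mulVec, dotProduct, Finset.mul_sum]
    rw [Finset.sum_comm]
    refine Finset.sum_congr rfl fun x _ => Finset.sum_congr rfl fun y _ => ?_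
    have := (hv0 x).ne'
    simp only [reversal, of_apply]
    field_simp
  simp only [mul_sub, Finset.sum_sub_distrib, h]
  congr 1
  exact Finset.sum_congr rfl fun x _ => by ring

variable {v : ι → ℝ}

/-- Bound for the expected reward collected on an excursion from `i`. -/
lemma IsCommittor.mul_excursion_le {i j : ι} {q : ι → ℝ} (hq : IsCommittor A i j q)
    (hA : A.IsIrreducible) (hrow : ∀ i, ∑ j, A i j = 1) (hv0 : ∀ i, 0 < v i) (hv : v ᵥ* A = v)
    {f a : ι → ℝ} (hf : ∀ x, 0 ≤ f x) (ha : ∀ x, x ≠ i → a x - (A *ᵥ a) x = f x) (hai : a i = 0) :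
    v i * a j * (A *ᵥ q) i ≤ ∑ x, v x * f x := by
  classical
  -- Reward from `x` is at least that collected after passing through `j`: the difference is
  -- superharmonic off `{i, j}` and vanishes there.
  have hle : ∀ x, a j * q x ≤ a x := by
    have := hA.nonneg_of_superharmonic hrow (B := fun x => x = i ∨ x = j) (Or.inl rfl)
      (d := a - a j • q) (fun x hx => ?_) (fun x hx => ?_)
    · intro x
      simpa using this x
    · rw [not_or] at hx
      rw [mulVec_sub, mulVec_smul]
      simp only [Pi.sub_apply, Pi.smul_apply, smul_eq_mul, hq.harmonic x hx.1 hx.2]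
      linarith [ha x hx.1, hf x]
    · rcases hx with rfl | rfl
      · simp [hq.source, hai]
      · simp [hq.target]
  have h1 : a j * (A *ᵥ q) i ≤ (A *ᵥ a) i := by
    simp only [mulVec, dotProduct, Finset.mul_sum]
    refine Finset.sum_le_sum fun x _ => ?_
    nlinarith [hle x, hA.nonneg i x, mul_le_mul_of_nonneg_left (hle x) (hA.nonneg i x)]
  -- Since `a i = 0`, stationarity turns `v i * (A *ᵥ a) i` into the sum of `v x * f x` over `x ≠
  -- i`.
  have h2 := sum_mul_sub_mulVec_of_stationary hv a
  rw [← Finset.add_sum_erase _ _ (Finset.mem_univ i), hai,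
    Finset.sum_congr rfl fun x hx => by rw [ha x (Finset.ne_of_mem_erase hx)]] at h2
  rw [← Finset.add_sum_erase _ _ (Finset.mem_univ i)]
  have h3 := mul_nonneg (hv0 i).le (hf i)
  nlinarith [mul_le_mul_of_nonneg_left h1 (hv0 i).le]

/-- Bound for the expected reward collected from `i` until the first visit to `j`. -/
lemma IsCommittor.mul_hitting_le {i j : ι} {q : ι → ℝ} (hij : j ≠ i) (hq : IsCommittor A i j q)
    (hA : A.IsIrreducible) (hrow : ∀ i, ∑ j, A i j = 1) (hv0 : ∀ i, 0 < v i) (hv : v ᵥ* A = v)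
    {f a : ι → ℝ} (hf : ∀ x, 0 ≤ f x) (ha : ∀ x, x ≠ j → a x - (A *ᵥ a) x = f x) (haj : a j = 0) :
    v i * a i * (A *ᵥ q) i ≤ ∑ x, v x * f x := by
  classical
  have hrowR := reversal_row_sum hv0 hv
  have hAR := hA.reversal hv0
  obtain ⟨s, hs⟩ := hAR.exists_isCommittor hrowR hij
  have hs' := hs.symm hrowR
  have hq' := hq.symm hrow
  have hsle : ∀ x, 1 - s x ≤ 1 := fun x => by linarith [hs.nonneg hAR hrowR x]
  -- `1 - s` is harmonic for the reversed chain off `{i, j}`; with `b j = 0` only the term at `i`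
  -- survives.
  have key : ∀ b : ι → ℝ, b j = 0 →
      ∑ x, v x * b x * ((1 - s x) - (A.reversal v *ᵥ fun x => 1 - s x) x) =
        v i * b i * (A.reversal v *ᵥ s) i := by
    intro b hb
    rw [Finset.sum_eq_single i]
    · have h : (fun x => 1 - s x) = -fun x => s x - 1 := by funext x; simp
      rw [h, mulVec_neg, Pi.neg_apply, mulVec_sub_const_of_row_sum hrowR, hs.source]
      ring
    · intro x _ hx
      rcases eq_or_ne x j with rfl | hxj
      · rw [hb]; ring
      · rw [hs'.harmonic x hxj hx]; ring
    · simp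
  -- Symmetry of capacity: pairing `1 - s` with `1 - q` from either side shows that the chain and
  -- its reversal have the same escape probability.
  have hcap : (A.reversal v *ᵥ s) i = (A *ᵥ q) i := by
    have h1 := key (fun x => 1 - q x) (by simp [hq.target])
    rw [← sum_mul_sub_reversal_mulVec hv0, Finset.sum_eq_single i] at h1
    · have h : (fun x => 1 - q x) = -fun x => q x - 1 := by funext x; simp
      rw [h, mulVec_neg, Pi.neg_apply, mulVec_sub_const_of_row_sum hrow, hq.source, hs.source] at h1
      have := (hv0 i).ne'
      have h2 : v i * ((A *ᵥ q) i - (A.reversal v *ᵥ s) i) = 0 := by linarith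
      rcases mul_eq_zero.1 h2 with h | h
      · contradiction
      · linarith
    · intro x _ hx
      rcases eq_or_ne x j with rfl | hxj
      · rw [hs.target]; ring
      · rw [hq'.harmonic x hxj hx]; ring
    · simp
  -- The left side becomes `∑ v (1 - s) (a - A a)`. The weight `1 - s` is at most one and vanishes
  -- at `j`, the only point where the equation for `a` is not available.
  have h2 := key a haj
  rw [← sum_mul_sub_reversal_mulVec hv0, hcap] at h2
  rw [← h2]
  refine Finset.sum_le_sum fun x _ => ?_
  rcases eq_or_ne x j with rfl | hxj
  · rw [hs.target]
    simpa using mul_nonneg (hv0 x).le (hf x)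
  · rw [ha x hxj]
    have := mul_nonneg (hv0 x).le (hf x)
    nlinarith [hsle x]

/-- Increments of a solution of Poisson's equation are controlled by visit probabilities. -/
lemma IsCommittor.mul_abs_sub_le {i j : ι} {q : ι → ℝ} (hij : j ≠ i) (hq : IsCommittor A i j q)
    (hA : A.IsIrreducible) (hrow : ∀ i, ∑ j, A i j = 1) (hv0 : ∀ i, 0 < v i) (hv : v ᵥ* A = v)
    {f h : ι → ℝ} {c : ℝ} (hf : ∀ x, 0 ≤ f x) (hc : 0 ≤ c)
    (hh : ∀ x, h x - (A *ᵥ h) x = f x - c) :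
    v i * |h j - h i| * (A *ᵥ q) i ≤ ∑ x, v x * f x := by
  classical
  -- `a` is the expected reward `f` before hitting `k`. Dropping `-c ≤ 0` from the source makes `a -
  -- (h - h k)` superharmonic off `k`, with value zero at `k`.
  have green : ∀ k, ∃ a : ι → ℝ, a k = 0 ∧ (∀ x, x ≠ k → a x - (A *ᵥ a) x = f x) ∧
      ∀ x, h x - h k ≤ a x := by
    intro k
    obtain ⟨a, ha0, ha⟩ := hA.exists_dirichlet hrow (fun x => x = k) rfl (Function.update f k 0)
    have ha' : ∀ x, x ≠ k → a x - (A *ᵥ a) x = f x := fun x hx => by simpa [hx] using ha x hx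
    have hak : a k = 0 := by simpa using ha0 k rfl
    refine ⟨a, hak, ha', ?_⟩
    have := hA.nonneg_of_superharmonic hrow (B := fun x => x = k) rfl
      (d := a - fun x => h x - h k) (fun x hx => ?_) (fun x hx => ?_)
    · intro x
      simpa using this x
    · rw [mulVec_sub, Pi.sub_apply, mulVec_sub_const_of_row_sum hrow, Pi.sub_apply]
      linarith [ha' x hx, hh x]
    · subst hx
      simp [hak]
  have hQ := hq.pos hA hrow
  have hvQ : 0 ≤ v i * (A *ᵥ q) i := mul_nonneg (hv0 i).le hQ.le
  rcases abs_cases (h j - h i) with ⟨habs, -⟩ | ⟨habs, -⟩ <;> rw [habs]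
  · obtain ⟨a, hai, ha, hle⟩ := green i
    refine le_trans ?_ (hq.mul_excursion_le hA hrow hv0 hv hf ha hai)
    nlinarith [mul_le_mul_of_nonneg_left (hle j) hvQ]
  · obtain ⟨a, haj, ha, hle⟩ := green j
    refine le_trans ?_ (hq.mul_hitting_le hij hA hrow hv0 hv hf ha haj)
    nlinarith [mul_le_mul_of_nonneg_left (hle i) hvQ]

/-- Solvability of Poisson's equation for an irreducible stochastic matrix. -/
lemma IsIrreducible.exists_poisson [Nonempty ι] (hA : A.IsIrreducible)
    (hrow : ∀ i, ∑ j, A i j = 1) (hv0 : ∀ i, 0 < v i) (hv : v ᵥ* A = v) (f : ι → ℝ) :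
    ∃ h : ι → ℝ, ∀ x, h x - (A *ᵥ h) x = f x - (∑ y, v y * f y) / ∑ y, v y := by
  classical
  obtain ⟨k⟩ := ‹Nonempty ι›
  have hsum : 0 < ∑ y, v y := Finset.sum_pos (fun y _ => hv0 y) ⟨k, Finset.mem_univ k⟩
  set c := (∑ y, v y * f y) / ∑ y, v y with hc
  obtain ⟨h, -, hh⟩ := hA.exists_dirichlet hrow (fun x => x = k) rfl
    (fun x => if x = k then 0 else f x - c)
  have hh' : ∀ x, x ≠ k → h x - (A *ᵥ h) x = f x - c := fun x hx => by simpa [hx] using hh x hx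
  refine ⟨h, fun x => ?_⟩
  rcases eq_or_ne x k with rfl | hx
  · have h1 := sum_mul_sub_mulVec_of_stationary hv h
    have h2 : ∑ y, v y * (f y - c) = 0 := by
      simp only [mul_sub, Finset.sum_sub_distrib, ← Finset.sum_mul, hc]
      field_simp
      ring
    rw [← Finset.add_sum_erase _ _ (Finset.mem_univ x)] at h1 h2
    rw [Finset.sum_congr rfl fun y hy => by rw [hh' y (Finset.ne_of_mem_erase hy)]] at h1
    exact mul_left_cancel₀ (hv0 x).ne' (by linarith)
  · exact hh' x hx

end Matrix

/-! ### Visit probabilities of the chain as committor values. -/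

namespace Emus

variable {L : ℕ} {A : Matrix (Fin L) (Fin L) ℝ}

open Preorder Matrix

lemma integral_stepKernel (hnn : ∀ i j, 0 ≤ A i j) (hrow : ∀ i, ∑ j, A i j = 1)
    (φ : Fin L → ℝ) (i : Fin L) : ∫ y, φ y ∂(stepKernel A i) = (A *ᵥ φ) i := by
  change ∫ y, φ y ∂(stepMeasure A i) = _
  rw [stepMeasure, if_pos ⟨hnn i, hrow i⟩, integral_finsetSum_measure fun _ _ =>
    (integrable_dirac (by simp)).smul_measure ENNReal.ofReal_ne_top]
  simp [integral_smul_measure, mulVec, dotProduct, hnn]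

instance (A : Matrix (Fin L) (Fin L) ℝ) (i : Fin L) : IsProbabilityMeasure (chainLaw A i) := by
  unfold chainLaw; infer_instance

lemma integrable_chainLaw (i : Fin L) (n : ℕ) (g : (Π _ : Finset.Iic n, Fin L) → ℝ) :
    Integrable (fun x => g (frestrictLe (π := fun _ => Fin L) n x)) (chainLaw A i) := by
  have : IsFiniteMeasure ((chainLaw A i).map (frestrictLe (π := fun _ => Fin L) n)) := inferInstance
  have h : Integrable g ((chainLaw A i).map (frestrictLe (π := fun _ => Fin L) n)) := .of_finite
  exact h.comp_measurable (measurable_frestrictLe n)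

lemma integral_chainLaw_zero (i : Fin L) (φ : Fin L → ℝ) :
    ∫ x, φ (x 0) ∂(chainLaw A i) = φ i := by
  have h : (chainLaw A i).map (frestrictLe (π := fun _ => Fin L) 0) =
      (Measure.dirac i).map (MeasurableEquiv.piUnique fun _ : Finset.Iic 0 => Fin L).symm := by
    rw [chainLaw, Kernel.trajMeasure, Measure.map_comp _ _ (by fun_prop),
      Kernel.traj_map_frestrictLe, Kernel.partialTraj_self, Measure.id_comp]
  have h2 := integral_map (μ := chainLaw A i) (φ := frestrictLe (π := fun _ => Fin L) 0)
    (by fun_prop) (f := fun g => φ (g ⟨0, by simp⟩)) (Measurable.of_discrete.aestronglyMeasurable)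
  rw [h, integral_map (by fun_prop) (Measurable.of_discrete.aestronglyMeasurable),
    integral_dirac] at h2
  exact h2.symm

/-- The Markov property of the chain. -/
lemma integral_chainLaw_succ (hnn : ∀ i j, 0 ≤ A i j) (hrow : ∀ i, ∑ j, A i j = 1) (i : Fin L)
    (n : ℕ) (g : (Π _ : Finset.Iic n, Fin L) → ℝ) (φ : Fin L → ℝ) :
    ∫ x, g (frestrictLe (π := fun _ => Fin L) n x) * φ (x (n + 1)) ∂(chainLaw A i) =
      ∫ x, g (frestrictLe (π := fun _ => Fin L) n x) * (A *ᵥ φ) (x n) ∂(chainLaw A i) := by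
  let κ : (n : ℕ) → Kernel (Π _ : Finset.Iic n, Fin L) (Fin L) := fun n =>
    (stepKernel A).comap (fun h : (Π _ : Finset.Iic n, Fin L) => h ⟨n, by simp⟩)
      (measurable_pi_apply _)
  have h := Kernel.map_frestrictLe_trajMeasure_compProd_eq_map_trajMeasure
    (X := fun _ => Fin L) (μ₀ := Measure.dirac i) (κ := κ) (a := n)
  change (chainLaw A i).map (frestrictLe (π := fun _ => Fin L) n) ⊗ₘ κ n =
    (chainLaw A i).map _ at h
  have h2 := congrArg (fun m => ∫ p, g p.1 * φ p.2 ∂m) h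
  rw [integral_map (by fun_prop) (Measurable.of_discrete.aestronglyMeasurable),
    Measure.integral_compProd .of_finite,
    integral_map (by fun_prop) (Measurable.of_discrete.aestronglyMeasurable)] at h2
  rw [← h2]
  refine integral_congr_ae (.of_forall fun x => ?_)
  simp only [integral_const_mul]
  congr 1
  exact integral_stepKernel hnn hrow φ (x n)

variable (i j : Fin L)

/-- The chain has not met `{i, j}` at the times `1, …, n`. -/
def Avoids (n : ℕ) (x : ℕ → Fin L) : Prop := ∀ m, 1 ≤ m → m ≤ n → x m ≠ i ∧ x m ≠ j

/-- The chain visits `j` at one of the times `1, …, n`, before returning to `i`. -/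
def VisitsBy (n : ℕ) (x : ℕ → Fin L) : Prop :=
  ∃ m, 1 ≤ m ∧ m ≤ n ∧ x m = j ∧ ∀ k, 1 ≤ k → k < m → x k ≠ i

open Classical in
/-- Integrals of functions of the first `n + 1` states, killed on hitting `{i, j}`. -/
noncomputable def killed (A : Matrix (Fin L) (Fin L) ℝ) (n : ℕ) (φ : Fin L → ℝ) : ℝ :=
  ∫ x, (if Avoids i j n x then 1 else 0) * φ (x n) ∂(chainLaw A i)

variable {i j}

lemma Avoids.succ_iff {n : ℕ} {x : ℕ → Fin L} :
    Avoids i j (n + 1) x ↔ Avoids i j n x ∧ x (n + 1) ≠ i ∧ x (n + 1) ≠ j := by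
  constructor
  · exact fun h => ⟨fun m h1 h2 => h m h1 (by omega), h (n + 1) (by omega) le_rfl⟩
  · rintro ⟨h, h'⟩ m h1 h2
    rcases Nat.lt_or_ge n m with h3 | h3
    · obtain rfl : m = n + 1 := by omega
      exact h'
    · exact h m h1 h3

lemma VisitsBy.succ_iff {n : ℕ} {x : ℕ → Fin L} :
    VisitsBy i j (n + 1) x ↔ VisitsBy i j n x ∨ (Avoids i j n x ∧ x (n + 1) = j) := by
  constructor
  · rintro ⟨m, h1, h2, hj, hi⟩
    by_cases h : VisitsBy i j n x
    · exact Or.inl h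
    right
    obtain rfl : m = n + 1 := by
      by_contra hne
      exact h ⟨m, h1, by omega, hj, hi⟩
    exact ⟨fun k hk1 hk2 => ⟨hi k hk1 (by omega), fun hkj =>
      h ⟨k, hk1, hk2, hkj, fun l hl1 hl2 => hi l hl1 (by omega)⟩⟩, hj⟩
  · rintro (⟨m, h1, h2, h3⟩ | ⟨h, hj⟩)
    · exact ⟨m, h1, by omega, h3⟩
    · exact ⟨n + 1, by omega, le_rfl, hj, fun k h1 h2 => (h k h1 (by omega)).1⟩

lemma Avoids.not_visitsBy {n : ℕ} {x : ℕ → Fin L} (h : Avoids i j n x) : ¬ VisitsBy i j n x :=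
  fun ⟨m, h1, h2, h3, _⟩ => (h m h1 h2).2 h3

lemma avoids_congr {n : ℕ} {x y : ℕ → Fin L} (h : ∀ m ≤ n, x m = y m) :
    Avoids i j n x ↔ Avoids i j n y := by
  refine forall_congr' fun m => forall_congr' fun _ => forall_congr' fun hm => ?_
  rw [h m hm]

lemma visitsBy_congr {n : ℕ} {x y : ℕ → Fin L} (h : ∀ m ≤ n, x m = y m) :
    VisitsBy i j n x ↔ VisitsBy i j n y := by
  refine exists_congr fun m => and_congr_right fun _ => and_congr_right fun hm => ?_
  rw [h m hm]
  refine and_congr_right fun _ => forall_congr' fun k => forall_congr' fun _ =>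
    forall_congr' fun hk => ?_
  rw [h k (by omega)]

/-- The path that follows `g` up to time `n` and then stays constant. -/
def extend (n : ℕ) (g : Π _ : Finset.Iic n, Fin L) (m : ℕ) : Fin L := g ⟨min m n, by simp⟩

lemma extend_frestrictLe (n : ℕ) (x : ℕ → Fin L) {m : ℕ} (hm : m ≤ n) :
    extend n (frestrictLe (π := fun _ => Fin L) n x) m = x m := by
  simp [extend, frestrictLe, min_eq_left hm]

open Classical in
lemma integral_avoids_succ (hnn : ∀ i j, 0 ≤ A i j) (hrow : ∀ i, ∑ j, A i j = 1) (n : ℕ)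
    (φ : Fin L → ℝ) :
    ∫ x, (if Avoids i j n x then 1 else 0) * φ (x (n + 1)) ∂(chainLaw A i) =
      killed i j A n (A *ᵥ φ) := by
  have h := integral_chainLaw_succ hnn hrow i n (fun g => if Avoids i j n (extend n g) then 1 else 0) φ
  have h2 : ∀ x : ℕ → Fin L, Avoids i j n (extend n (frestrictLe (π := fun _ => Fin L) n x)) ↔
      Avoids i j n x := fun x => avoids_congr fun m hm => extend_frestrictLe n x hm
  simpa only [h2, killed] using h

/-- A function of finitely many states factors through a finite space. -/
lemma integrable_of_prefix {n : ℕ} {f : (ℕ → Fin L) → ℝ}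
    (hf : ∀ x y, (∀ m ≤ n, x m = y m) → f x = f y) : Integrable f (chainLaw A i) := by
  have h := integrable_chainLaw (A := A) i n fun g => f (extend n g)
  have h2 : ∀ x : ℕ → Fin L, f (extend n (frestrictLe (π := fun _ => Fin L) n x)) = f x :=
    fun x => hf _ _ fun m hm => extend_frestrictLe n x hm
  simpa only [h2] using h

open Classical in
lemma integrable_killed (n : ℕ) (φ : Fin L → ℝ) :
    Integrable (fun x => (if Avoids i j n x then 1 else 0) * φ (x n)) (chainLaw A i) :=
  integrable_of_prefix (n := n) fun x y h => by simp only [avoids_congr h, h n le_rfl]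

open Classical in
lemma integrable_visitsBy (n : ℕ) :
    Integrable (fun x => if VisitsBy i j n x then (1 : ℝ) else 0) (chainLaw A i) :=
  integrable_of_prefix (n := n) fun x y h => by simp only [visitsBy_congr h]

lemma measurableSet_visitsBy (n : ℕ) : MeasurableSet {x : ℕ → Fin L | VisitsBy i j n x} := by
  have h2 : {x : ℕ → Fin L | VisitsBy i j n x} = frestrictLe (π := fun _ => Fin L) n ⁻¹'
      {g | VisitsBy i j n (extend n g)} := by
    ext x
    exact (visitsBy_congr fun m hm => extend_frestrictLe n x hm).symm
  rw [h2]
  exact (measurable_frestrictLe n) .of_discrete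

/-- At time 0 the chain sits at `i` without being killed, hence `1 ≤ n`; later a surviving path is
off `{i, j}`. -/
lemma killed_congr {n : ℕ} (hn : 1 ≤ n) {φ φ' : Fin L → ℝ}
    (h : ∀ x, x ≠ i → x ≠ j → φ x = φ' x) : killed i j A n φ = killed i j A n φ' := by
  refine integral_congr_ae (.of_forall fun x => ?_)
  by_cases hx : Avoids i j n x
  · simp [hx, h _ (hx n hn le_rfl).1 (hx n hn le_rfl).2]
  · simp [hx]

lemma killed_mono {n : ℕ} {φ φ' : Fin L → ℝ} (h : ∀ x, φ x ≤ φ' x) :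
    killed i j A n φ ≤ killed i j A n φ' := by
  refine integral_mono (integrable_killed n φ) (integrable_killed n φ') fun x => ?_
  by_cases hx : Avoids i j n x <;> simp [hx, h]

lemma killed_sub (n : ℕ) (φ φ' : Fin L → ℝ) :
    killed i j A n (φ - φ') = killed i j A n φ - killed i j A n φ' := by
  rw [killed, killed, killed, ← integral_sub (integrable_killed n φ) (integrable_killed n φ')]
  simp [mul_sub]

lemma killed_smul (n : ℕ) (c : ℝ) (φ : Fin L → ℝ) :
    killed i j A n (c • φ) = c * killed i j A n φ := by
  rw [killed, killed, ← integral_const_mul]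
  congr 1 with x
  simp [mul_left_comm]

lemma killed_zero (φ : Fin L → ℝ) : killed i j A 0 φ = φ i := by
  have : ∀ x : ℕ → Fin L, Avoids i j 0 x := fun x m h1 h2 => by omega
  simp [killed, this, integral_chainLaw_zero]

/-- The chain almost surely returns to `{i, j}`. -/
lemma tendsto_killed_one (hA : A.IsIrreducible) (hrow : ∀ i, ∑ j, A i j = 1) :
    Tendsto (fun n => killed i j A n 1) atTop (𝓝 0) := by
  classical
  -- `t` is the expected hitting time of `{i, j}`. Its killed integrals drop by the survival
  -- probability at each step, so these probabilities are summable.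
  obtain ⟨t, ht0, ht⟩ := hA.exists_dirichlet hrow (fun x => x = i ∨ x = j) (Or.inl rfl)
    (fun x => if x = i ∨ x = j then 0 else 1)
  have ht0' : ∀ x, x = i ∨ x = j → t x = 0 := fun x hx => by simpa [hx] using ht0 x hx
  have ht' : ∀ x, ¬ (x = i ∨ x = j) → t x - (A *ᵥ t) x = 1 := fun x hx => by
    simpa [hx] using ht x hx
  have htnn := hA.nonneg_of_superharmonic hrow (B := fun x => x = i ∨ x = j) (Or.inl rfl)
    (d := t) (fun x hx => by linarith [ht' x hx]) (fun x hx => (ht0' x hx).ge)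
  have hk : ∀ n, 1 ≤ n → killed i j A (n + 1) t = killed i j A n t - killed i j A n 1 := by
    intro n hn
    rw [← killed_sub, killed_congr (φ' := A *ᵥ t) hn fun x hxi hxj => by
      simp only [Pi.sub_apply, Pi.one_apply]; linarith [ht' x (by tauto)],
      ← integral_avoids_succ hA.nonneg hrow]
    refine integral_congr_ae (.of_forall fun x => ?_)
    by_cases h1 : Avoids i j n x <;> by_cases h2 : x (n + 1) = i ∨ x (n + 1) = j
    · simp [ht0' _ h2]
    · rw [not_or] at h2
      simp [Avoids.succ_iff, h1, h2]
    · simp [ht0' _ h2]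
    · simp [Avoids.succ_iff, h1]
  have hnn : ∀ n φ, (∀ x, 0 ≤ φ x) → 0 ≤ killed i j A n φ := fun n φ hφ =>
    integral_nonneg fun x => mul_nonneg (by split_ifs <;> simp) (hφ _)
  have hsum : ∀ n, ∑ m ∈ Finset.range n, killed i j A (m + 1) 1 =
      killed i j A 1 t - killed i j A (n + 1) t := by
    intro n
    induction n with
    | zero => simp
    | succ n ih => rw [Finset.sum_range_succ, ih, hk (n + 1) (by omega)]; ring
  have hs : Summable fun m => killed i j A (m + 1) 1 :=
    summable_of_sum_range_le (c := killed i j A 1 t) (fun m => hnn _ _ fun _ => zero_le_one)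
      fun n => by rw [hsum]; linarith [hnn (n + 1) t htnn]
  exact (tendsto_add_atTop_iff_nat 1).1 hs.tendsto_atTop_zero

/-- Visit probabilities are given by the committor. -/
lemma visitProb_eq (hA : A.IsIrreducible) (hrow : ∀ i, ∑ j, A i j = 1) {q : Fin L → ℝ}
    (hq : IsCommittor A i j q) : visitProb A i j = (A *ᵥ q) i := by
  classical
  -- On a path still alive at time `n`, the new visit indicator plus the surviving part of `q`
  -- equals `q (x (n + 1))`, because `q` is 1 at `j` and 0 at `i`.
  have hone : ∀ n, ∫ x, (if VisitsBy i j (n + 1) x then (1 : ℝ) else 0) ∂(chainLaw A i) =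
      (∫ x, (if VisitsBy i j n x then (1 : ℝ) else 0) ∂(chainLaw A i)) +
        killed i j A n (A *ᵥ q) - killed i j A (n + 1) q := by
    intro n
    have hint : Integrable (fun x => (if Avoids i j n x then 1 else 0) * q (x (n + 1)))
        (chainLaw A i) := integrable_of_prefix (n := n + 1) fun x y h => by
      simp only [avoids_congr fun m (hm : m ≤ n) => h m (by omega), h _ le_rfl]
    have hint' := integrable_killed (A := A) (i := i) (j := j) (n + 1) q
    rw [← integral_avoids_succ hA.nonneg hrow, killed, add_sub_assoc, ← integral_sub hint hint']
    have hadd := integral_add (integrable_visitsBy (A := A) (i := i) (j := j) n) (hint.sub hint')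
    simp only [Pi.sub_apply] at hadd
    rw [← hadd]
    refine integral_congr_ae (.of_forall fun x => ?_)
    by_cases h1 : Avoids i j n x
    · have h2 := h1.not_visitsBy
      by_cases hj : x (n + 1) = j
      · simp [Avoids.succ_iff, VisitsBy.succ_iff, h1, h2, hj, hq.target]
      · by_cases hi : x (n + 1) = i
        · simp [Avoids.succ_iff, VisitsBy.succ_iff, h1, h2, hi, hq.source]
          exact fun h => hj (hi.trans h)
        · simp [Avoids.succ_iff, VisitsBy.succ_iff, h1, h2, hi, hj]
    · simp [Avoids.succ_iff, VisitsBy.succ_iff, h1]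
  -- Visits so far plus the surviving `q` are conserved from time 1 on. The first step starts at
  -- `i`, where `q` need not be harmonic, which is why the constant is `(A *ᵥ q) i` and not `q i`.
  have hinv : ∀ n, ∫ x, (if VisitsBy i j (n + 1) x then (1 : ℝ) else 0) ∂(chainLaw A i) =
      (A *ᵥ q) i - killed i j A (n + 1) q := by
    intro n
    induction n with
    | zero =>
      have h0 : ∀ x : ℕ → Fin L, ¬ VisitsBy i j 0 x := fun x ⟨m, h1, h2, _⟩ => by omega
      rw [hone, killed_zero]
      simp [h0]
    | succ n ih => rw [hone, ih, killed_congr (φ' := q) (by omega) hq.harmonic]; ring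
  obtain ⟨C, hC⟩ := (Set.finite_range q).bddAbove
  have hqC : ∀ x, q x ≤ (C • (1 : Fin L → ℝ)) x := fun x => by simpa using hC ⟨x, rfl⟩
  have hlim : Tendsto (fun n => killed i j A (n + 1) q) atTop (𝓝 0) := by
    refine squeeze_zero (g := fun n => C * killed i j A (n + 1) 1) (fun n => ?_) (fun n => ?_) ?_
    · exact integral_nonneg fun x =>
        mul_nonneg (by split_ifs <;> simp) (hq.nonneg hA hrow _)
    · rw [← killed_smul]
      exact killed_mono hqC
    · simpa using ((tendsto_add_atTop_iff_nat 1).2 (tendsto_killed_one hA hrow)).const_mul C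
  have hmono : Monotone fun n => {x : ℕ → Fin L | VisitsBy i j n x} :=
    fun a b hab x ⟨m, h1, h2, h3⟩ => ⟨m, h1, h2.trans hab, h3⟩
  have hset : {X : ℕ → Fin L | ∃ n, 1 ≤ n ∧ X n = j ∧ ∀ m, 1 ≤ m → m < n → X m ≠ i} =
      ⋃ n, {x | VisitsBy i j n x} := by
    ext x
    simp only [Set.mem_ofPred_eq, Set.mem_iUnion, VisitsBy]
    exact ⟨fun ⟨n, h1, h2⟩ => ⟨n, n, h1, le_rfl, h2⟩, fun ⟨_, m, h1, _, h2⟩ => ⟨m, h1, h2⟩⟩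
  have h1 : Tendsto (fun n => (chainLaw A i).real {x | VisitsBy i j n x}) atTop
      (𝓝 (visitProb A i j)) := by
    rw [visitProb, hset]
    exact (ENNReal.tendsto_toReal (measure_ne_top _ _)).comp (tendsto_measure_iUnion_atTop hmono)
  have h2 : ∀ n, (chainLaw A i).real {x | VisitsBy i j n x} =
      ∫ x, (if VisitsBy i j n x then (1 : ℝ) else 0) ∂(chainLaw A i) := fun n => by
    rw [← integral_indicator_one (measurableSet_visitsBy n)]
    rfl
  refine tendsto_nhds_unique ((tendsto_add_atTop_iff_nat 1).2 h1) ?_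
  simp only [h2, hinv]
  simpa using hlim.const_sub ((A *ᵥ q) i)

end Emus

/-! ### Central limit theorem for randomly weighted sample means. -/

namespace ProbabilityTheory

/-- Independent arrays: the rows of a jointly independent array are independent. -/
lemma iIndepFun.curry {Ω 𝓧 ι κ : Type*} [MeasurableSpace Ω] [MeasurableSpace 𝓧] [Countable ι]
    [Countable κ] {P : Measure Ω} {X : ι → κ → Ω → 𝓧} (mX : ∀ i j, AEMeasurable (X i j) P)
    (h : iIndepFun (fun p : ι × κ => X p.1 p.2) P) : iIndepFun (fun i ω j => X i j ω) P := by
  have := h.isProbabilityMeasure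
  have hprob : ∀ i j, IsProbabilityMeasure (P.map (X i j)) :=
    fun i j => Measure.isProbabilityMeasure_map (mX i j)
  rw [iIndepFun_iff_map_fun_eq_infinitePi_map₀
    (aemeasurable_pi_iff.2 fun i => aemeasurable_pi_iff.2 fun j => mX i j)]
  have h1 := h.map_fun_eq_infinitePi_map₀' fun p : ι × κ => mX p.1 p.2
  have h2 : ∀ i, P.map (fun ω j => X i j ω) = Measure.infinitePi fun j => P.map (X i j) :=
    fun i => (h.precomp (g := fun j : κ => (i, j))
      (Prod.mk_right_injective i)).map_fun_eq_infinitePi_map₀' fun j => mX i j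
  simp_rw [h2]
  rw [← Measure.infinitePi_map_curry (fun i j => P.map (X i j)), ← h1,
    AEMeasurable.map_map_of_aemeasurable (by fun_prop)
      (aemeasurable_pi_iff.2 fun p : ι × κ => mX p.1 p.2)]
  rfl

end ProbabilityTheory

namespace MeasureTheory

variable {Ω : Type*} [MeasurableSpace Ω] {P : Measure Ω} [IsProbabilityMeasure P]

/-- Serves identities that hold only almost surely and for large indices, once all sample sizes are
positive and the eigenproblem is solved. -/
lemma TendstoInDistribution.congr_eventually {E Ω' : Type*} [TopologicalSpace E]
    [MeasurableSpace E] [OpensMeasurableSpace E] [MeasurableSpace Ω'] {μ' : Measure Ω'}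
    [IsProbabilityMeasure μ'] {X Y : ℕ → Ω → E} {Z : Ω' → E}
    (h : TendstoInDistribution X atTop Z (fun _ => P) μ') (hY : ∀ k, AEMeasurable (Y k) P)
    (hXY : ∀ᶠ k in atTop, X k =ᵐ[P] Y k) :
    TendstoInDistribution Y atTop Z (fun _ => P) μ' where
  forall_aemeasurable := hY
  aemeasurable_limit := h.aemeasurable_limit
  tendsto := h.tendsto.congr' <| by
    filter_upwards [hXY] with k hk
    exact Subtype.ext (Measure.map_congr hk)

lemma TendstoInDistribution.congr_limit {E Ω' Ω'' : Type*} [TopologicalSpace E]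
    [MeasurableSpace E] [OpensMeasurableSpace E] [MeasurableSpace Ω'] {μ' : Measure Ω'}
    [IsProbabilityMeasure μ'] [MeasurableSpace Ω''] {μ'' : Measure Ω''} [IsProbabilityMeasure μ'']
    {X : ℕ → Ω → E} {Z : Ω' → E} {Z' : Ω'' → E}
    (h : TendstoInDistribution X atTop Z (fun _ => P) μ') (hZ : IdentDistrib Z Z' μ' μ'') :
    TendstoInDistribution X atTop Z' (fun _ => P) μ'' where
  forall_aemeasurable := h.forall_aemeasurable
  aemeasurable_limit := hZ.aemeasurable_snd
  tendsto := by
    have hlim : (⟨μ'.map Z, Measure.isProbabilityMeasure_map h.aemeasurable_limit⟩ :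
        ProbabilityMeasure E) = ⟨μ''.map Z', Measure.isProbabilityMeasure_map hZ.aemeasurable_snd⟩ :=
      Subtype.ext hZ.map_eq
    exact hlim ▸ h.tendsto

/-- Marginal convergence of independent components implies joint convergence. -/
lemma TendstoInDistribution.pi {ι : Type*} [Fintype ι] {X : ι → ℕ → Ω → ℝ}
    {ν : ι → Measure ℝ} [∀ i, IsProbabilityMeasure (ν i)]
    (h : ∀ i, TendstoInDistribution (X i) atTop id (fun _ => P) (ν i))
    (hind : ∀ k, iIndepFun (fun i => X i k) P) :
    TendstoInDistribution (fun k ω i => X i k ω) atTop id (fun _ => P) (Measure.pi ν) where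
  forall_aemeasurable k := aemeasurable_pi_iff.2 fun i => (h i).forall_aemeasurable k
  aemeasurable_limit := aemeasurable_id
  tendsto := by
    have := (ProbabilityMeasure.continuous_pi.tendsto _).comp
      (tendsto_pi_nhds.2 fun i => (h i).tendsto)
    have hlim : (ProbabilityMeasure.pi fun i =>
        (⟨(ν i).map id, Measure.isProbabilityMeasure_map aemeasurable_id⟩ : ProbabilityMeasure ℝ)) =
        ⟨(Measure.pi ν).map id, Measure.isProbabilityMeasure_map aemeasurable_id⟩ :=
      Subtype.ext (by simp only [Measure.map_id]; rfl)
    rw [← hlim]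
    refine this.congr fun k => Subtype.ext ?_
    exact ((iIndepFun_iff_map_fun_eq_pi_map fun i => (h i).forall_aemeasurable k).1 (hind k)).symm

end MeasureTheory

namespace ProbabilityTheory

variable {ι : Type*} [Fintype ι]

/-- The coordinates are independent, so the characteristic functions of the scaled Gaussians
multiply. -/
lemma map_sum_mul_pi_gaussianReal (v : ι → ℝ≥0) (c : ι → ℝ) :
    (Measure.pi fun i => gaussianReal 0 (v i)).map (fun z => ∑ i, z i * c i) =
      gaussianReal 0 (∑ i, (c i ^ 2).toNNReal * v i) := by
  have hlaw : ∀ i, (Measure.pi fun i => gaussianReal 0 (v i)).map (fun z => z i * c i) =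
      (gaussianReal 0 (v i)).map (· * c i) := fun i => by
    rw [← (measurePreserving_eval (fun i => gaussianReal 0 (v i)) i).map_eq,
      Measure.map_map (by fun_prop) (by fun_prop)]
    rfl
  have hind : iIndepFun (fun i (z : ι → ℝ) => z i * c i)
      (Measure.pi fun i => gaussianReal 0 (v i)) :=
    iIndepFun_pi (X := fun i x => x * c i) fun i => (measurable_mul_const (c i)).aemeasurable
  refine Measure.ext_of_charFun ?_
  rw [hind.charFun_map_fun_sum_eq_prod fun i =>
    ((measurable_pi_apply i).mul_const (c i)).aemeasurable]
  ext t
  simp only [Finset.prod_apply, hlaw, gaussianReal_map_mul_const, charFun_gaussianReal]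
  rw [← Complex.exp_sum]
  congr 1
  simp only [mul_zero, Complex.ofReal_zero, zero_mul, zero_sub, Finset.sum_neg_distrib,
    NNReal.coe_sum, NNReal.coe_mul, Complex.ofReal_sum, Complex.ofReal_mul, Finset.sum_mul,
    Finset.sum_div]
  congr 1
  refine Finset.sum_congr rfl fun i _ => ?_
  simp [Real.coe_toNNReal _ (sq_nonneg (c i))]

variable {Ω : Type*} [MeasurableSpace Ω] {P : Measure Ω} [IsProbabilityMeasure P]

/-- Central limit theorem for a randomly weighted sum of sample means, over independent samples
whose sizes grow proportionally. -/
theorem tendstoInDistribution_sqrt_mul_weighted_means {Y : ι → ℕ → Ω → ℝ}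
    (hind : iIndepFun (fun q : ι × ℕ => Y q.1 q.2) P) (hY : ∀ i, MemLp (Y i 0) 2 P)
    (hid : ∀ i n, IdentDistrib (Y i n) (Y i 0) P P) {N : ℕ → ι → ℕ} {M : ℕ → ℕ}
    (hN : ∀ i, Tendsto (fun k => N k i) atTop atTop) {w : ι → ℝ}
    (hw : ∀ i, 0 < w i) (hNw : ∀ i, Tendsto (fun k => (N k i : ℝ) / M k) atTop (𝓝 (w i)))
    {c : ℕ → Ω → ι → ℝ} (hc : ∀ k, AEMeasurable (c k) P) {c' : ι → ℝ}
    (hcc' : ∀ᵐ ω ∂P, Tendsto (fun k => c k ω) atTop (𝓝 c')) :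
    TendstoInDistribution (fun k ω => √(M k) * ∑ i, c k ω i *
        (1 / (N k i : ℝ) * ∑ n ∈ Finset.range (N k i), Y i n ω - P[Y i 0]))
      atTop id (fun _ => P)
      (gaussianReal 0 (∑ i, ((c' i / √(w i)) ^ 2).toNNReal * Var[Y i 0; P].toNNReal)) := by
  have mY : ∀ i n, AEMeasurable (Y i n) P := fun i n => (hid i n).aemeasurable_fst
  let V : ι → ℕ → Ω → ℝ := fun i n ω =>
    (√n)⁻¹ * (∑ m ∈ Finset.range n, Y i m ω - n * P[Y i 0])
  have hV : ∀ i, TendstoInDistribution (fun k => V i (N k i)) atTop id (fun _ => P)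
      (gaussianReal 0 Var[Y i 0; P].toNNReal) := fun i => by
    have := tendstoInDistribution_inv_sqrt_mul_sum_sub (P := P) (X := Y i) (Y := id) .id (hY i)
      (hind.precomp (g := fun n => (i, n)) (Prod.mk_right_injective i)) (hid i)
    exact ⟨fun k => this.1 (N k i), this.2, this.3.comp (hN i)⟩
  have hVind : ∀ k, iIndepFun (fun i => V i (N k i)) P := fun k => by
    let g : ι → (ℕ → ℝ) → ℝ := fun i y =>
      (√(N k i))⁻¹ * (∑ m ∈ Finset.range (N k i), y m - N k i * P[Y i 0])
    exact (hind.curry mY).comp g fun i => by fun_prop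
  -- Each mean is normalised by its own `√(N k i)`; the common factor `√(M k)` leaves this weight,
  -- whence the limit `c' i / √(w i)`.
  let d : ℕ → Ω → ι → ℝ := fun k ω i => c k ω i * (√((N k i : ℝ) / M k))⁻¹
  have hd : ∀ k, AEMeasurable (d k) P := fun k =>
    aemeasurable_pi_iff.2 fun i => ((aemeasurable_pi_iff.1 (hc k)) i).mul_const _
  have hdlim : TendstoInMeasure P d atTop fun _ i => c' i / √(w i) := by
    refine tendstoInMeasure_of_tendsto_ae (fun k => (hd k).aestronglyMeasurable) ?_
    filter_upwards [hcc'] with ω hω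
    refine tendsto_pi_nhds.2 fun i => (tendsto_pi_nhds.1 hω i).mul ?_
    exact ((Real.continuous_sqrt.tendsto _).comp (hNw i)).inv₀ (Real.sqrt_pos.2 (hw i)).ne'
  -- Slutsky: the independent means converge jointly, and the weights converge in probability to
  -- constants.
  have key := (TendstoInDistribution.pi hV hVind).continuous_comp_prodMk_of_tendstoInMeasure_const
    (g := fun z : (ι → ℝ) × (ι → ℝ) => ∑ i, z.1 i * z.2 i) (by fun_prop) hdlim hd
  refine (key.congr_limit ?_).congr_eventually (fun k => ?_) ?_
  · refine ⟨by fun_prop, aemeasurable_id, ?_⟩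
    rw [Measure.map_id]
    exact map_sum_mul_pi_gaussianReal _ _
  · have := fun i => (aemeasurable_pi_iff.1 (hc k)) i
    fun_prop
  · have hpos : ∀ᶠ k in atTop, ∀ i, 0 < N k i ∧ 0 < (N k i : ℝ) / M k :=
      eventually_all.2 fun i => ((hN i).eventually_gt_atTop 0).and
        ((hNw i).eventually (lt_mem_nhds (hw i)))
    filter_upwards [hpos] with k hk
    refine .of_forall fun ω => ?_
    simp only [Finset.mul_sum]
    refine Finset.sum_congr rfl fun i _ => ?_
    have h1 : (0 : ℝ) < N k i := Nat.cast_pos.2 (hk i).1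
    have h2 : (0 : ℝ) < M k := by
      refine lt_of_le_of_ne (Nat.cast_nonneg _) fun h => ?_
      have := (hk i).2
      simp [← h] at this
    have h3 : √(N k i : ℝ) * √(N k i : ℝ) = N k i := Real.mul_self_sqrt h1.le
    have h4 : 0 < √(N k i : ℝ) := Real.sqrt_pos.2 h1
    have h5 : 0 < √(M k : ℝ) := Real.sqrt_pos.2 h2
    simp only [V, d]
    rw [Real.sqrt_div h1.le, inv_div]
    rw [← Finset.mul_sum]
    set S := ∑ m ∈ Finset.range (N k i), Y i m ω
    have h6 : S - N k i * P[Y i 0] = N k i * (1 / (N k i : ℝ) * S - P[Y i 0]) := by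
      field_simp
    rw [h6]
    nth_rw 2 [← h3]
    field_simp

end ProbabilityTheory

/-! ### Perturbation of the stationary vector. -/

namespace Matrix

variable {ι : Type*} [Fintype ι] {A : Matrix ι ι ℝ} {v : ι → ℝ}

/-- Exact perturbation formula for the stationary vector, tested against `f`. -/
lemma sum_mul_sub_sum_mul_of_stationary (hv : v ᵥ* A = v) {B : Matrix ι ι ℝ} {v' : ι → ℝ}
    (hv' : v' = B.transpose *ᵥ v') (hsum : ∑ i, v' i = ∑ i, v i) {f h : ι → ℝ} {c : ℝ}
    (hh : ∀ x, h x - (A *ᵥ h) x = f x - c) :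
    ∑ i, v' i * f i - ∑ i, v i * f i = ∑ i, v' i * ((B *ᵥ h) i - (A *ᵥ h) i) := by
  have h1 : ∑ i, v i * (f i - c) = 0 := by
    simp only [← hh]
    exact sum_mul_sub_mulVec_of_stationary hv h
  have h2 : ∑ i, v' i * (f i - c) = ∑ i, v' i * ((B *ᵥ h) i - (A *ᵥ h) i) := by
    -- Stationarity of `v'` for `B` allows `h` to be replaced by `B *ᵥ h` under the `v'`-average.
    have h3 := sum_mul_sub_mulVec_of_stationary
      (hv := (by rw [← mulVec_transpose]; exact hv'.symm : v' ᵥ* B = v')) h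
    simp only [← hh]
    rw [← sub_eq_zero, ← Finset.sum_sub_distrib, ← h3]
    exact Finset.sum_congr rfl fun i _ => by ring
  simp only [mul_sub, Finset.sum_sub_distrib, ← Finset.sum_mul, hsum] at h1 h2 ⊢
  linarith

/-- Continuity of the normalised stationary vector. -/
lemma IsIrreducible.tendsto_stationary [Nonempty ι] (hA : A.IsIrreducible)
    (hrow : ∀ i, ∑ j, A i j = 1) (hv0 : ∀ i, 0 < v i) (hv : v ᵥ* A = v)
    {B : ℕ → Matrix ι ι ℝ} (hB : ∀ i j, Tendsto (fun k => B k i j) atTop (𝓝 (A i j)))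
    {v' : ℕ → ι → ℝ} (hv' : ∀ᶠ k in atTop, v' k = (B k).transpose *ᵥ v' k)
    (hsum : ∀ᶠ k in atTop, ∑ i, v' k i = ∑ i, v i) : Tendsto v' atTop (𝓝 v) := by
  classical
  -- Testing against coordinate vectors recovers each entry of `v' - v`.
  choose h hh using fun m : ι => hA.exists_poisson hrow hv0 hv (Pi.single m 1)
  set D : ℕ → ℝ := fun k => ∑ m, ∑ i, |(B k *ᵥ h m) i - (A *ᵥ h m) i|
  have hD : Tendsto D atTop (𝓝 0) := by
    have : Tendsto D atTop (𝓝 (∑ m, ∑ i, |(A *ᵥ h m) i - (A *ᵥ h m) i|)) := by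
      refine tendsto_finsetSum _ fun m _ => tendsto_finsetSum _ fun i _ => ?_
      refine Tendsto.abs (Tendsto.sub_const ?_ _)
      exact tendsto_finsetSum _ fun j _ => (hB i j).mul_const _
    simpa using this
  set V := ∑ i, |v i|
  set s : ℕ → ℝ := fun k => ∑ m, |v' k m - v m|
  have hs0 : ∀ k, 0 ≤ s k := fun k => Finset.sum_nonneg fun _ _ => abs_nonneg _
  have hV0 : 0 ≤ V := Finset.sum_nonneg fun _ _ => abs_nonneg _
  -- No sign of `v'` is assumed, so its mass is bounded by `s k + V`; once `D k < 1/2` the `s k`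
  -- term is absorbed, giving `s k ≤ 2 * V * D k`.
  have hsD : ∀ᶠ k in atTop, s k ≤ (s k + V) * D k := by
    filter_upwards [hv', hsum] with k hk1 hk2
    have hle : ∑ i, |v' k i| ≤ s k + V := by
      rw [← Finset.sum_add_distrib]
      refine Finset.sum_le_sum fun i _ => ?_
      simpa using abs_add_le (v' k i - v i) (v i)
    refine le_trans ?_ (mul_le_mul_of_nonneg_right hle
      (Finset.sum_nonneg fun _ _ => Finset.sum_nonneg fun _ _ => abs_nonneg _))
    rw [Finset.mul_sum]
    refine Finset.sum_le_sum fun m _ => ?_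
    have h1 := sum_mul_sub_sum_mul_of_stationary hv hk1 hk2 (hh m)
    simp only [Pi.single_apply, mul_ite, mul_one, mul_zero, Finset.sum_ite_eq',
      Finset.mem_univ, if_true] at h1
    rw [h1, Finset.sum_mul]
    refine (Finset.abs_sum_le_sum_abs _ _).trans (Finset.sum_le_sum fun i _ => ?_)
    rw [abs_mul]
    exact mul_le_mul_of_nonneg_left (Finset.single_le_sum
      (f := fun i => |(B k *ᵥ h m) i - (A *ᵥ h m) i|) (fun _ _ => abs_nonneg _)
      (Finset.mem_univ i)) (abs_nonneg _)
  have hs : Tendsto s atTop (𝓝 0) := by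
    refine squeeze_zero' (g := fun k => 2 * V * D k) (.of_forall hs0) ?_ (by
      simpa using hD.const_mul (2 * V))
    filter_upwards [hsD, hD.eventually (gt_mem_nhds (by norm_num : (0 : ℝ) < 1 / 2))] with k h1 h2
    nlinarith [mul_le_mul_of_nonneg_left h2.le (hs0 k)]
  refine tendsto_pi_nhds.2 fun m => tendsto_iff_dist_tendsto_zero.2 ?_
  refine squeeze_zero (fun _ => dist_nonneg) (fun k => ?_) hs
  rw [Real.dist_eq]
  exact Finset.single_le_sum (f := fun m => |v' k m - v m|) (fun _ _ => abs_nonneg _)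
    (Finset.mem_univ m)

end Matrix

/-! ### Variance inequalities. -/

namespace ProbabilityTheory

variable {Ω : Type*} [MeasurableSpace Ω] {P : Measure Ω} [IsProbabilityMeasure P]

/-- Pointwise Cauchy–Schwarz for the centred variables; independence plays no role. -/
lemma variance_sum_le_card_mul {ι : Type*} {s : Finset ι} {X : ι → Ω → ℝ}
    (hX : ∀ i ∈ s, MemLp (X i) 2 P) :
    Var[fun ω => ∑ i ∈ s, X i ω; P] ≤ s.card * ∑ i ∈ s, Var[X i; P] := by
  have hint : ∀ i ∈ s, Integrable (X i) P := fun i hi => (hX i hi).integrable one_le_two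
  have hsq : ∀ i ∈ s, Integrable (fun ω => (X i ω - P[X i]) ^ 2) P := fun i hi =>
    ((hX i hi).sub (memLp_const _)).integrable_sq
  rw [variance_eq_integral (memLp_finsetSum s hX).aemeasurable, integral_finsetSum s hint,
    Finset.sum_congr rfl fun i hi => variance_eq_integral (hX i hi).aemeasurable,
    ← integral_finsetSum s hsq, ← integral_const_mul]
  refine integral_mono ?_ ((integrable_finsetSum s hsq).const_mul _) fun ω => ?_
  · exact ((memLp_finsetSum s hX).sub (memLp_const _)).integrable_sq
  · simp only
    rw [← Finset.sum_sub_distrib]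
    exact sq_sum_le_card_mul_sum_sq

lemma variance_add_le_two_mul {X Y : Ω → ℝ} (hX : MemLp X 2 P) (hY : MemLp Y 2 P) :
    Var[fun ω => X ω + Y ω; P] ≤ 2 * (Var[X; P] + Var[Y; P]) := by
  have h := variance_sum_le_card_mul (P := P) (s := Finset.univ) (X := ![X, Y])
    (by simpa [Fin.forall_fin_two] using ⟨hX, hY⟩)
  simpa [Fin.sum_univ_two] using h

end ProbabilityTheory

/-! ### Ratios, the matrix `F` and the averaging identity. -/

namespace Emus

section Model

variable {Θ Λ : Type*} {L : ℕ} {ψ : Λ → Θ → ℝ} {p : Λ → ℝ} {grid : Fin L → Λ} {l : Λ}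

lemma le_mixture (hψ_nonneg : ∀ l θ, 0 ≤ ψ l θ) (hp_grid : ∀ i, 0 < p (grid i)) (i : Fin L)
    (θ : Θ) : ψ (grid i) θ * p (grid i) ≤ mixture ψ p grid θ :=
  Finset.single_le_sum (f := fun i => ψ (grid i) θ * p (grid i))
    (fun j _ => mul_nonneg (hψ_nonneg _ θ) (hp_grid j).le) (Finset.mem_univ i)

lemma mixture_nonneg (hψ_nonneg : ∀ l θ, 0 ≤ ψ l θ) (hp_grid : ∀ i, 0 < p (grid i)) (θ : Θ) :
    0 ≤ mixture ψ p grid θ :=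
  Finset.sum_nonneg fun j _ => mul_nonneg (hψ_nonneg _ θ) (hp_grid j).le

lemma ratio_nonneg (hψ_nonneg : ∀ l θ, 0 ≤ ψ l θ) (hp_grid : ∀ i, 0 < p (grid i)) (hp : 0 < p l)
    (θ : Θ) : 0 ≤ ratio ψ p grid l θ :=
  div_nonneg (mul_nonneg (hψ_nonneg _ θ) hp.le) (mixture_nonneg hψ_nonneg hp_grid θ)

lemma ratio_grid_le_one (hψ_nonneg : ∀ l θ, 0 ≤ ψ l θ) (hp_grid : ∀ i, 0 < p (grid i))
    (i : Fin L) (θ : Θ) : ratio ψ p grid (grid i) θ ≤ 1 :=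
  div_le_one_of_le₀ (le_mixture hψ_nonneg hp_grid i θ) (mixture_nonneg hψ_nonneg hp_grid θ)

lemma mixture_pos_of_grid (hψ_nonneg : ∀ l θ, 0 ≤ ψ l θ) (hp_grid : ∀ i, 0 < p (grid i))
    (i : Fin L) {θ : Θ} (h : 0 < ψ (grid i) θ) : 0 < mixture ψ p grid θ :=
  (mul_pos h (hp_grid i)).trans_le (le_mixture hψ_nonneg hp_grid i θ)

lemma sum_ratio_grid {θ : Θ} (h : mixture ψ p grid θ ≠ 0) :
    ∑ j, ratio ψ p grid (grid j) θ = 1 := by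
  simp only [ratio, ← Finset.sum_div]
  exact div_self h

variable [MeasurableSpace Θ] {μ : Measure Θ}

lemma isProbabilityMeasure_localLaw (hψ_nonneg : ∀ θ, 0 ≤ ψ l θ)
    (hψ_int : Integrable (ψ l) μ) (hz : 0 < z μ ψ l) : IsProbabilityMeasure (localLaw μ ψ l) := by
  constructor
  rw [localLaw, withDensity_apply _ .univ, Measure.restrict_univ,
    ← ofReal_integral_eq_lintegral_ofReal (hψ_int.div_const _)
    (.of_forall fun θ => div_nonneg (hψ_nonneg θ) hz.le), integral_div]
  change ENNReal.ofReal (z μ ψ l / z μ ψ l) = 1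
  rw [div_self hz.ne', ENNReal.ofReal_one]

lemma integral_localLaw (hψ_meas : Measurable (ψ l)) (hψ_nonneg : ∀ θ, 0 ≤ ψ l θ)
    (hz : 0 < z μ ψ l) (g : Θ → ℝ) :
    ∫ θ, g θ ∂(localLaw μ ψ l) = ∫ θ, g θ * (ψ l θ / z μ ψ l) ∂μ := by
  rw [localLaw, integral_withDensity_eq_integral_toReal_smul (by fun_prop)
    (.of_forall fun _ => ENNReal.ofReal_lt_top)]
  refine integral_congr_ae (.of_forall fun θ => ?_)
  simp only [smul_eq_mul]
  rw [ENNReal.toReal_ofReal (div_nonneg (hψ_nonneg θ) hz.le), mul_comm]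

lemma integrable_localLaw_iff (hψ_meas : Measurable (ψ l)) (hψ_nonneg : ∀ θ, 0 ≤ ψ l θ)
    (hz : 0 < z μ ψ l) (g : Θ → ℝ) :
    Integrable g (localLaw μ ψ l) ↔ Integrable (fun θ => g θ * (ψ l θ / z μ ψ l)) μ := by
  rw [localLaw, integrable_withDensity_iff_integrable_smul' (by fun_prop)
    (.of_forall fun _ => ENNReal.ofReal_lt_top)]
  refine integrable_congr (.of_forall fun θ => ?_)
  simp only [smul_eq_mul]
  rw [ENNReal.toReal_ofReal (div_nonneg (hψ_nonneg θ) hz.le), mul_comm]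

lemma measurable_ratio (hψ_meas : ∀ l, Measurable (ψ l)) (l : Λ) :
    Measurable (ratio ψ p grid l) := by
  have h : Measurable fun θ => ψ l θ * p l / ∑ i, ψ (grid i) θ * p (grid i) := by fun_prop
  exact h

/-- Almost every point for `π_{λ_i}` has `ψ (grid i) θ > 0`, hence a positive mixture; where the
mixture vanishes, division by zero makes the sum 0. -/
lemma ae_sum_ratio_grid (hψ_meas : ∀ l, Measurable (ψ l)) (hψ_nonneg : ∀ l θ, 0 ≤ ψ l θ)
    (hp_grid : ∀ i, 0 < p (grid i)) (i : Fin L) :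
    ∀ᵐ θ ∂(localLaw μ ψ (grid i)), ∑ j, ratio ψ p grid (grid j) θ = 1 := by
  have := hψ_meas (grid i)
  rw [localLaw, ae_withDensity_iff (by fun_prop)]
  refine .of_forall fun θ hθ => sum_ratio_grid (mixture_pos_of_grid hψ_nonneg hp_grid i ?_).ne'
  refine lt_of_le_of_ne (hψ_nonneg _ θ) fun h => hθ ?_
  simp [← h]

lemma memLp_ratio_grid (hψ_meas : ∀ l, Measurable (ψ l)) (hψ_nonneg : ∀ l θ, 0 ≤ ψ l θ)
    (hp_grid : ∀ i, 0 < p (grid i)) (ν : Measure Θ) [IsFiniteMeasure ν] (j : Fin L) (q : ℝ≥0∞) :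
    MemLp (ratio ψ p grid (grid j)) q ν := by
  refine MemLp.of_bound (measurable_ratio hψ_meas _).aestronglyMeasurable 1 (.of_forall fun θ => ?_)
  rw [Real.norm_of_nonneg (ratio_nonneg hψ_nonneg hp_grid (hp_grid j) θ)]
  exact ratio_grid_le_one hψ_nonneg hp_grid j θ

lemma F_apply (hψ_meas : ∀ l, Measurable (ψ l)) (hψ_nonneg : ∀ l θ, 0 ≤ ψ l θ)
    (hz : ∀ l, 0 < z μ ψ l) (i j : Fin L) :
    F μ ψ p grid i j = ∫ θ, ratio ψ p grid (grid j) θ ∂(localLaw μ ψ (grid i)) := by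
  rw [integral_localLaw (hψ_meas _) (hψ_nonneg _) (hz _)]
  rfl

lemma F_row_sum (hψ_meas : ∀ l, Measurable (ψ l)) (hψ_nonneg : ∀ l θ, 0 ≤ ψ l θ)
    (hψ_int : ∀ l, Integrable (ψ l) μ) (hz : ∀ l, 0 < z μ ψ l) (hp_grid : ∀ i, 0 < p (grid i))
    (i : Fin L) : ∑ j, F μ ψ p grid i j = 1 := by
  have := isProbabilityMeasure_localLaw (hψ_nonneg (grid i)) (hψ_int _) (hz _)
  simp only [F_apply hψ_meas hψ_nonneg hz]
  rw [← integral_finsetSum _ fun j _ =>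
    (memLp_ratio_grid hψ_meas hψ_nonneg hp_grid _ j 1).integrable le_rfl,
    integral_congr_ae (ae_sum_ratio_grid hψ_meas hψ_nonneg hp_grid i)]
  simp

lemma sum_z_mul_pos [NeZero L] (hz : ∀ l, 0 < z μ ψ l) (hp_grid : ∀ i, 0 < p (grid i)) :
    0 < ∑ i, z μ ψ (grid i) * p (grid i) :=
  Finset.sum_pos (fun i _ => mul_pos (hz _) (hp_grid i)) ⟨0, Finset.mem_univ _⟩

lemma u_pos [NeZero L] (hz : ∀ l, 0 < z μ ψ l) (hp_grid : ∀ i, 0 < p (grid i)) (hp : 0 < p l) :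
    0 < u μ ψ p grid l :=
  div_pos (mul_pos (Nat.cast_pos.2 (NeZero.pos L)) (mul_pos (hz l) hp)) (sum_z_mul_pos hz hp_grid)

lemma sum_u_grid [NeZero L] (hz : ∀ l, 0 < z μ ψ l) (hp_grid : ∀ i, 0 < p (grid i)) :
    ∑ i, u μ ψ p grid (grid i) = L := by
  simp only [u, ← Finset.sum_div, ← Finset.mul_sum]
  exact mul_div_cancel_right₀ _ (sum_z_mul_pos hz hp_grid).ne'

/-- The averaging identity `∑ i, u_i E_{π_i}[ρ_l] = u(l)`. -/
lemma sum_u_mul_integral_ratio (hψ_meas : ∀ l, Measurable (ψ l))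
    (hψ_nonneg : ∀ l θ, 0 ≤ ψ l θ) (hz : ∀ l, 0 < z μ ψ l)
    (hsupp : ∀ᵐ θ ∂μ, 0 < ψ l θ → 0 < mixture ψ p grid θ)
    (hint : ∀ i, Integrable (ratio ψ p grid l) (localLaw μ ψ (grid i))) :
    ∑ i, u μ ψ p grid (grid i) * ∫ θ, ratio ψ p grid l θ ∂(localLaw μ ψ (grid i)) =
      u μ ψ p grid l := by
  set Z := ∑ i, z μ ψ (grid i) * p (grid i) with hZ
  have h1 : ∀ i, u μ ψ p grid (grid i) * ∫ θ, ratio ψ p grid l θ ∂(localLaw μ ψ (grid i)) =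
      L / Z * ∫ θ, ratio ψ p grid l θ * (ψ (grid i) θ * p (grid i)) ∂μ := fun i => by
    rw [integral_localLaw (hψ_meas _) (hψ_nonneg _) (hz _), u, ← hZ, ← integral_const_mul,
      ← integral_const_mul]
    congr 1 with θ
    have := (hz (grid i)).ne'
    field_simp
  have h2 : ∀ i, Integrable (fun θ => ratio ψ p grid l θ * (ψ (grid i) θ * p (grid i))) μ := by
    intro i
    refine (((integrable_localLaw_iff (hψ_meas _) (hψ_nonneg _) (hz _) _).1 (hint i)).const_mul
      (z μ ψ (grid i) * p (grid i))).congr (.of_forall fun θ => ?_)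
    have := (hz (grid i)).ne'
    simp only
    field_simp
  simp only [h1]
  rw [← Finset.mul_sum, ← integral_finsetSum _ fun i _ => h2 i]
  -- Summing over the grid cancels the mixture in the denominator; where the mixture is zero, the
  -- support condition gives `ψ l θ = 0` almost everywhere.
  have h3 : ∫ θ, ∑ i, ratio ψ p grid l θ * (ψ (grid i) θ * p (grid i)) ∂μ = z μ ψ l * p l := by
    rw [z, ← integral_mul_const]
    refine integral_congr_ae ?_
    filter_upwards [hsupp] with θ hθ
    rw [← Finset.mul_sum]
    change ratio ψ p grid l θ * mixture ψ p grid θ = _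
    rcases (hψ_nonneg l θ).eq_or_lt with h | h
    · simp [ratio, ← h]
    · exact div_mul_cancel₀ _ (hθ h).ne'
  rw [h3, u, ← hZ]
  ring

lemma u_vecMul_F (hψ_meas : ∀ l, Measurable (ψ l)) (hψ_nonneg : ∀ l θ, 0 ≤ ψ l θ)
    (hψ_int : ∀ l, Integrable (ψ l) μ) (hz : ∀ l, 0 < z μ ψ l) (hp_grid : ∀ i, 0 < p (grid i)) :
    Matrix.vecMul (fun i => u μ ψ p grid (grid i)) (F μ ψ p grid) =
      fun i => u μ ψ p grid (grid i) := by
  have := fun l => isProbabilityMeasure_localLaw (hψ_nonneg l) (hψ_int l) (hz l)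
  funext j
  simp only [Matrix.vecMul, dotProduct, F_apply hψ_meas hψ_nonneg hz]
  exact sum_u_mul_integral_ratio hψ_meas hψ_nonneg hz
    (.of_forall fun θ => mixture_pos_of_grid hψ_nonneg hp_grid j) fun i =>
      (memLp_ratio_grid hψ_meas hψ_nonneg hp_grid _ j 1).integrable le_rfl

/-- The variance of a combination of the grid ratios, in terms of increments of coefficients. -/
lemma variance_sum_mul_ratio_grid_le (hψ_meas : ∀ l, Measurable (ψ l))
    (hψ_nonneg : ∀ l θ, 0 ≤ ψ l θ) (hψ_int : ∀ l, Integrable (ψ l) μ)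
    (hz : ∀ l, 0 < z μ ψ l) (hp_grid : ∀ i, 0 < p (grid i)) (h : Fin L → ℝ) (i : Fin L) :
    Var[fun θ => ∑ j, h j * ratio ψ p grid (grid j) θ; localLaw μ ψ (grid i)] ≤
      L * ∑ j ∈ Finset.univ.erase i, (h j - h i) ^ 2 * R μ ψ p grid i j := by
  have := isProbabilityMeasure_localLaw (hψ_nonneg (grid i)) (hψ_int _) (hz _)
  have hmem : ∀ j, MemLp (fun θ => (h j - h i) * ratio ψ p grid (grid j) θ) 2
      (localLaw μ ψ (grid i)) := fun j =>
    (memLp_ratio_grid hψ_meas hψ_nonneg hp_grid _ j 2).const_mul _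
  -- Since the ratios sum to one, subtracting `h i` from all coefficients only shifts by a constant
  -- and removes the term `j = i`.
  have h1 : (fun θ => ∑ j, h j * ratio ψ p grid (grid j) θ) =ᵐ[localLaw μ ψ (grid i)]
      fun θ => (∑ j ∈ Finset.univ.erase i, (h j - h i) * ratio ψ p grid (grid j) θ) + h i := by
    filter_upwards [ae_sum_ratio_grid hψ_meas hψ_nonneg hp_grid i] with θ hθ
    rw [Finset.sum_erase _ (by simp)]
    simp only [sub_mul, Finset.sum_sub_distrib, ← Finset.mul_sum, hθ]
    ring
  rw [variance_congr h1, variance_add_const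
    (memLp_finsetSum _ fun j _ => hmem j).aestronglyMeasurable]
  refine (variance_sum_le_card_mul fun j _ => hmem j).trans ?_
  simp only [variance_const_mul]
  have hcard : ((Finset.univ.erase i).card : ℝ) ≤ L := by
    have := Finset.card_erase_le (s := Finset.univ) (a := i)
    rw [Finset.card_univ, Fintype.card_fin] at this
    exact_mod_cast this
  exact mul_le_mul_of_nonneg_right hcard
    (Finset.sum_nonneg fun j _ => mul_nonneg (sq_nonneg _) (variance_nonneg _ _))

end Model

end Emus

/-! ### Error representation, consistency and the variance bound. -/

namespace Emus

variable {Θ Λ : Type*} {L : ℕ} {ψ : Λ → Θ → ℝ} {p : Λ → ℝ} {grid : Fin L → Λ} {l : Λ}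

/-- Exact representation of the error of the functional estimator. -/
lemma uHat_sub_eq {N : Fin L → ℕ} {x : Fin L → ℕ → Θ} {v v' f h : Fin L → ℝ}
    {A : Matrix (Fin L) (Fin L) ℝ} (hv : Matrix.vecMul v A = v)
    (hv' : IsEmusSolution ψ p grid N x v') (hsum : ∑ i, v i = L) {c : ℝ}
    (hh : ∀ i, h i - A.mulVec h i = f i - c) :
    uHat ψ p grid N x v' l - ∑ i, v i * f i = ∑ i, v' i *
      (1 / (N i : ℝ) * ∑ n ∈ Finset.range (N i), (ratio ψ p grid l (x i n) +
        ∑ j, h j * ratio ψ p grid (grid j) (x i n)) - (f i + A.mulVec h i)) := by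
  have h1 := Matrix.sum_mul_sub_sum_mul_of_stationary hv hv'.1 (hv'.2.trans hsum.symm) hh
  have h2 : ∀ i, 1 / (N i : ℝ) * ∑ n ∈ Finset.range (N i), (ratio ψ p grid l (x i n) +
      ∑ j, h j * ratio ψ p grid (grid j) (x i n)) =
      fHat ψ p grid N x i l + (FHat ψ p grid N x).mulVec h i := by
    intro i
    simp only [Finset.sum_add_distrib, mul_add, fHat, FHat, Matrix.mulVec, dotProduct,
      Matrix.of_apply]
    rw [Finset.sum_comm, Finset.mul_sum (s := Finset.univ)]
    refine congrArg _ (Finset.sum_congr rfl fun j _ => ?_)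
    rw [← Finset.mul_sum]
    ring
  simp only [h2, uHat]
  -- The error splits into sampling noise in `f̂`, weighted by `v'`, and the error of `v'` tested
  -- against `f`, which the perturbation formula rewrites.
  rw [← sub_add_sub_cancel _ (∑ i, v' i * f i), h1, ← Finset.sum_sub_distrib,
    ← Finset.sum_add_distrib]
  exact Finset.sum_congr rfl fun i _ => by ring

variable [MeasurableSpace Θ] {μ : Measure Θ}

/-- Sample sizes with positive limiting proportions tend to infinity. -/
lemma tendsto_sample_size {N : ℕ → Fin L → ℕ} {w : Fin L → ℝ} (hw : ∀ i, 0 < w i)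
    (hN : Tendsto (fun k => ∑ i, N k i) atTop atTop)
    (hNw : ∀ i, Tendsto (fun k => (N k i : ℝ) / ((∑ j, N k j : ℕ) : ℝ)) atTop (𝓝 (w i)))
    (i : Fin L) : Tendsto (fun k => N k i) atTop atTop := by
  have h := (hNw i).pos_mul_atTop (hw i) (tendsto_natCast_atTop_atTop.comp hN)
  refine tendsto_natCast_atTop_iff.1 (h.congr' ?_)
  filter_upwards [hN.eventually_gt_atTop 0] with k hk
  have : ((∑ j, N k j : ℕ) : ℝ) ≠ 0 := Nat.cast_ne_zero.2 hk.ne'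
  simp only [Function.comp]
  exact div_mul_cancel₀ _ this

/-- Strong law of large numbers for the sample means `f̂`. -/
lemma ae_tendsto_fHat {Ω : Type*} [MeasurableSpace Ω] {P : Measure Ω}
    {x : Fin L → ℕ → Ω → Θ} {ν : Fin L → Measure Θ} (hx : ∀ i n, HasLaw (x i n) (ν i) P)
    (hind : iIndepFun (fun q : Fin L × ℕ => x q.1 q.2) P) {N : ℕ → Fin L → ℕ}
    (hN : ∀ i, Tendsto (fun k => N k i) atTop atTop) (hψ_meas : ∀ l, Measurable (ψ l)) (i : Fin L)
    (hint : Integrable (ratio ψ p grid l) (ν i)) :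
    ∀ᵐ ω ∂P, Tendsto (fun k => fHat ψ p grid (N k) (fun i n => x i n ω) i l) atTop
      (𝓝 (∫ θ, ratio ψ p grid l θ ∂(ν i))) := by
  have hmeas := measurable_ratio (p := p) (grid := grid) hψ_meas l
  have hident : ∀ n, IdentDistrib (x i n) (x i 0) P P := fun n =>
    ⟨(hx i n).aemeasurable, (hx i 0).aemeasurable, (hx i n).map_eq.trans (hx i 0).map_eq.symm⟩
  have h1 := strong_law_ae_real (fun n ω => ratio ψ p grid l (x i n ω))
    (((hx i 0).map_eq.symm ▸ hint).comp_aemeasurable (hx i 0).aemeasurable)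
    (fun m n hmn => ((hind.indepFun (i := (i, m)) (j := (i, n))
      fun h => hmn (Prod.ext_iff.1 h).2).comp hmeas hmeas))
    (fun n => (hident n).comp hmeas)
  have h2 : P[fun ω => ratio ψ p grid l (x i 0 ω)] = ∫ θ, ratio ψ p grid l θ ∂(ν i) :=
    (hx i 0).integral_comp hmeas.aestronglyMeasurable
  rw [h2] at h1
  filter_upwards [h1] with ω hω
  refine (hω.comp (hN i)).congr fun k => ?_
  simp only [fHat, Function.comp]
  ring

/-- Bound for the asymptotic variance of the functional estimator. -/
lemma asymptoticVariance_div_le [NeZero L]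
    (hψ_meas : ∀ l, Measurable (ψ l)) (hψ_nonneg : ∀ l θ, 0 ≤ ψ l θ)
    (hψ_int : ∀ l, Integrable (ψ l) μ) (hz : ∀ l, 0 < z μ ψ l) (hp_grid : ∀ i, 0 < p (grid i))
    (hp : 0 < p l) (hF : (F μ ψ p grid).IsIrreducible) {w : Fin L → ℝ} (hw : ∀ i, 0 < w i)
    (hmem : ∀ i, MemLp (ratio ψ p grid l) 2 (localLaw μ ψ (grid i))) {h f : Fin L → ℝ}
    (hf : ∀ i, 0 ≤ f i) (huf : ∑ i, u μ ψ p grid (grid i) * f i = u μ ψ p grid l)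
    {c : ℝ} (hc : 0 ≤ c) (hh : ∀ i, h i - (F μ ψ p grid).mulVec h i = f i - c) :
    (∑ i, u μ ψ p grid (grid i) ^ 2 / w i * Var[fun θ => ratio ψ p grid l θ +
        ∑ j, h j * ratio ψ p grid (grid j) θ; localLaw μ ψ (grid i)]) / u μ ψ p grid l ^ 2 ≤
      2 * ∑ i, (w i)⁻¹ *
        (L * ∑ j ∈ Finset.univ.erase i, R μ ψ p grid i j / visitProb (F μ ψ p grid) i j ^ 2 +
          u μ ψ p grid (grid i) ^ 2 * (r μ ψ p grid i l).toReal / u μ ψ p grid l ^ 2) := by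
  have := fun l => isProbabilityMeasure_localLaw (hψ_nonneg l) (hψ_int l) (hz l)
  have hul : 0 < u μ ψ p grid l := u_pos hz hp_grid hp
  have hrow := F_row_sum hψ_meas hψ_nonneg hψ_int hz hp_grid
  have hR : ∀ i j, 0 ≤ R μ ψ p grid i j := fun i j => variance_nonneg _ _
  -- Square of the increment bound `u_i |h_j - h_i| Q_ij ≤ ∑ u f = u(l)`; the factors `u_i²` cancel.
  have hinc : ∀ i, ∀ j ∈ Finset.univ.erase i,
      u μ ψ p grid (grid i) ^ 2 * ((h j - h i) ^ 2 * R μ ψ p grid i j) / u μ ψ p grid l ^ 2 ≤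
        R μ ψ p grid i j / visitProb (F μ ψ p grid) i j ^ 2 := by
    intro i j hj
    have hij := Finset.ne_of_mem_erase hj
    obtain ⟨q, hq⟩ := hF.exists_isCommittor hrow hij
    have h1 := hq.mul_abs_sub_le hij hF hrow (fun i => u_pos hz hp_grid (hp_grid i))
      (u_vecMul_F hψ_meas hψ_nonneg hψ_int hz hp_grid) hf hc hh
    have hQ := hq.pos hF hrow
    rw [huf] at h1
    rw [visitProb_eq hF hrow hq]
    have hui : 0 < u μ ψ p grid (grid i) := u_pos hz hp_grid (hp_grid i)
    have h2 := pow_le_pow_left₀ (by positivity) h1 2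
    rw [mul_pow, mul_pow, sq_abs] at h2
    rw [div_le_div_iff₀ (by positivity) (by positivity)]
    calc _ = R μ ψ p grid i j * (u μ ψ p grid (grid i) ^ 2 * (h j - h i) ^ 2 *
          (F μ ψ p grid).mulVec q i ^ 2) := by ring
      _ ≤ _ := mul_le_mul_of_nonneg_left h2 (hR i j)
  rw [Finset.sum_div, Finset.mul_sum]
  refine Finset.sum_le_sum fun i _ => ?_
  -- The factor 2 comes from separating `ρ_l` from the combination of grid ratios.
  have hvar : Var[fun θ => ratio ψ p grid l θ +
      ∑ j, h j * ratio ψ p grid (grid j) θ; localLaw μ ψ (grid i)] ≤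
      2 * ((r μ ψ p grid i l).toReal +
        L * ∑ j ∈ Finset.univ.erase i, (h j - h i) ^ 2 * R μ ψ p grid i j) :=
    (variance_add_le_two_mul (hmem i) (memLp_finsetSum _ fun j _ =>
      (memLp_ratio_grid hψ_meas hψ_nonneg hp_grid _ j 2).const_mul (h j))).trans <| by
      gcongr
      · exact le_rfl
      · exact variance_sum_mul_ratio_grid_le hψ_meas hψ_nonneg hψ_int hz hp_grid h i
  have hsum := Finset.sum_le_sum (hinc i)
  rw [← Finset.sum_div, ← Finset.mul_sum] at hsum
  have hwi := hw i
  calc _ ≤ u μ ψ p grid (grid i) ^ 2 / w i * (2 * ((r μ ψ p grid i l).toReal +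
        L * ∑ j ∈ Finset.univ.erase i, (h j - h i) ^ 2 * R μ ψ p grid i j)) /
          u μ ψ p grid l ^ 2 := by gcongr
    _ = 2 * ((w i)⁻¹ * (L * (u μ ψ p grid (grid i) ^ 2 * (∑ j ∈ Finset.univ.erase i,
          (h j - h i) ^ 2 * R μ ψ p grid i j) / u μ ψ p grid l ^ 2) +
          u μ ψ p grid (grid i) ^ 2 * (r μ ψ p grid i l).toReal / u μ ψ p grid l ^ 2)) := by
        field_simp
        ring
    _ ≤ _ := by gcongr

end Emus

/-! ### The limit theorem. -/

theorem mainTheorem5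
    {Θ : Type*} [MeasurableSpace Θ] (μ : Measure Θ) {Λ : Type*}
    (ψ : Λ → Θ → ℝ) (p : Λ → ℝ) (L : ℕ) [NeZero L] (grid : Fin L → Λ)
    (hψ_meas : ∀ l, Measurable (ψ l))
    (hψ_nonneg : ∀ l θ, 0 ≤ ψ l θ)
    (hψ_int : ∀ l, Integrable (ψ l) μ)
    (hz : ∀ l, 0 < Emus.z μ ψ l)
    (hp_grid : ∀ i, 0 < p (grid i))
    (l : Λ) (hp : 0 < p l)
    -- the grid densities cover the support of `ψ l` (automatic if all `ψ` are strictly positive)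
    (hsupp : ∀ᵐ θ ∂μ, 0 < ψ l θ → 0 < Emus.mixture ψ p grid θ)
    (hF : (Emus.F μ ψ p grid).IsIrreducible)
    (w : Fin L → ℝ) (hw : ∀ i, 0 < w i)
    (hr : ∀ i, Emus.r μ ψ p grid i l < ∞) :
    -- `v` is the asymptotic variance `σ²(l)`
    ∃ v : ℝ≥0,
      (∀ {Ω : Type*} [MeasurableSpace Ω] (P : Measure Ω) [IsProbabilityMeasure P]
        -- independent samples, `x i n` being drawn from `π_{λ_i}`
        (x : Fin L → ℕ → Ω → Θ)
        (_ : ∀ i n, HasLaw (x i n) (Emus.localLaw μ ψ (grid i)) P)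
        (_ : iIndepFun (fun q : Fin L × ℕ => x q.1 q.2) P)
        -- sample sizes, with total going to infinity and limiting proportions `w`
        (N : ℕ → Fin L → ℕ)
        (_ : Tendsto (fun k => ∑ i, N k i) atTop atTop)
        (_ : ∀ i, Tendsto (fun k => (N k i : ℝ) / ((∑ j, N k j : ℕ) : ℝ)) atTop (𝓝 (w i)))
        -- the EMUS estimators `û` on the grid
        (uGrid : ℕ → Ω → Fin L → ℝ)
        (_ : ∀ k, AEMeasurable (uGrid k) P)
        (_ : ∀ᶠ k in atTop, ∀ᵐ ω ∂P,
          Emus.IsEmusSolution ψ p grid (N k) (fun i n => x i n ω) (uGrid k ω)),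
        TendstoInDistribution
          (fun k ω => √((∑ i, N k i : ℕ) : ℝ) *
            (Emus.uHat ψ p grid (N k) (fun i n => x i n ω) (uGrid k ω) l - Emus.u μ ψ p grid l))
          atTop id (fun _ => P) (gaussianReal 0 v)) ∧
      (v : ℝ) / Emus.u μ ψ p grid l ^ 2 ≤
        2 * ∑ i, (w i)⁻¹ *
          (L * ∑ j ∈ Finset.univ.erase i,
              Emus.R μ ψ p grid i j / Emus.visitProb (Emus.F μ ψ p grid) i j ^ 2 +
            Emus.u μ ψ p grid (grid i) ^ 2 * (Emus.r μ ψ p grid i l).toReal /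
              Emus.u μ ψ p grid l ^ 2) := by
  have hprob := fun l => Emus.isProbabilityMeasure_localLaw (hψ_nonneg l) (hψ_int l) (hz l)
  have hmeas := Emus.measurable_ratio (p := p) (grid := grid) hψ_meas
  have hmem : ∀ i, MemLp (Emus.ratio ψ p grid l) 2 (Emus.localLaw μ ψ (grid i)) := fun i =>
    (evariance_lt_top_iff_memLp (hmeas l).aestronglyMeasurable).1 (hr i)
  have hmem_grid := fun i j => Emus.memLp_ratio_grid hψ_meas hψ_nonneg hp_grid
    (Emus.localLaw μ ψ (grid i)) j 2
  have hrow := Emus.F_row_sum hψ_meas hψ_nonneg hψ_int hz hp_grid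
  have hu0 : ∀ i, 0 < Emus.u μ ψ p grid (grid i) := fun i => Emus.u_pos hz hp_grid (hp_grid i)
  have hu := Emus.u_vecMul_F hψ_meas hψ_nonneg hψ_int hz hp_grid
  have husum := Emus.sum_u_grid (μ := μ) hz hp_grid
  have hul := Emus.u_pos (μ := μ) hz hp_grid hp
  let f : Fin L → ℝ := fun i => ∫ θ, Emus.ratio ψ p grid l θ ∂(Emus.localLaw μ ψ (grid i))
  have hf : ∀ i, 0 ≤ f i := fun i =>
    integral_nonneg fun θ => Emus.ratio_nonneg hψ_nonneg hp_grid hp θ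
  have huf : ∑ i, Emus.u μ ψ p grid (grid i) * f i = Emus.u μ ψ p grid l :=
    Emus.sum_u_mul_integral_ratio hψ_meas hψ_nonneg hz hsupp fun i =>
      (hmem i).integrable one_le_two
  obtain ⟨h, hh⟩ := hF.exists_poisson hrow hu0 hu f
  rw [huf, husum] at hh
  let g : Θ → ℝ := fun θ => Emus.ratio ψ p grid l θ + ∑ j, h j * Emus.ratio ψ p grid (grid j) θ
  have hg : Measurable g := (hmeas l).add
    (Finset.measurable_fun_sum _ fun j _ => (hmeas (grid j)).const_mul (h j))
  have hg_mem : ∀ i, MemLp g 2 (Emus.localLaw μ ψ (grid i)) := fun i =>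
    (hmem i).add (memLp_finsetSum _ fun j _ => (hmem_grid i j).const_mul (h j))
  have hg_int : ∀ i, ∫ θ, g θ ∂(Emus.localLaw μ ψ (grid i)) =
      f i + (Emus.F μ ψ p grid).mulVec h i := fun i => by
    have hint := fun j => ((hmem_grid i j).integrable one_le_two).const_mul (h j)
    rw [integral_add ((hmem i).integrable one_le_two) (integrable_finsetSum _ fun j _ => hint j),
      integral_finsetSum _ fun j _ => hint j]
    simp only [f, Matrix.mulVec, dotProduct, integral_const_mul,
      Emus.F_apply hψ_meas hψ_nonneg hz]
    congr 1
    exact Finset.sum_congr rfl fun j _ => mul_comm _ _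
  -- The weights are the limits `u_i / √(w i)`, so the variance depends only on the model and `w`.
  refine ⟨∑ i, ((Emus.u μ ψ p grid (grid i) / √(w i)) ^ 2).toNNReal *
    Var[g; Emus.localLaw μ ψ (grid i)].toNNReal, ?_, ?_⟩
  · intro Ω _ P _ x hx hind N hN hNw uGrid huGrid hsol
    have hNi := Emus.tendsto_sample_size hw hN hNw
    have hlim : ∀ᵐ ω ∂P, Tendsto (fun k => uGrid k ω) atTop
        (𝓝 fun i => Emus.u μ ψ p grid (grid i)) := by
      have h1 : ∀ᵐ ω ∂P, ∀ i j, Tendsto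
          (fun k => Emus.FHat ψ p grid (N k) (fun i n => x i n ω) i j) atTop
          (𝓝 (Emus.F μ ψ p grid i j)) := by
        refine ae_all_iff.2 fun i => ae_all_iff.2 fun j => ?_
        rw [Emus.F_apply hψ_meas hψ_nonneg hz]
        exact Emus.ae_tendsto_fHat (ν := fun i => Emus.localLaw μ ψ (grid i)) hx hind hNi hψ_meas i
          ((hmem_grid i j).integrable one_le_two)
      -- The null sets, one for each index from `K` on, are countably many and merge into one.
      obtain ⟨K, hK⟩ := eventually_atTop.1 hsol
      have h2 : ∀ᵐ ω ∂P, ∀ k, K ≤ k →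
          Emus.IsEmusSolution ψ p grid (N k) (fun i n => x i n ω) (uGrid k ω) :=
        ae_all_iff.2 fun k => eventually_imp_distrib_left.2 (hK k)
      filter_upwards [h1, h2] with ω hω1 hω2
      exact hF.tendsto_stationary hrow hu0 hu hω1
        (eventually_atTop.2 ⟨K, fun k hk => (hω2 k hk).1⟩)
        (eventually_atTop.2 ⟨K, fun k hk => (hω2 k hk).2.trans husum.symm⟩)
    have hYlaw : ∀ i n, P.map (fun ω => g (x i n ω)) = (Emus.localLaw μ ψ (grid i)).map g :=
      fun i n => by
        rw [← (hx i n).map_eq, AEMeasurable.map_map_of_aemeasurable hg.aemeasurable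
          (hx i n).aemeasurable]
        rfl
    have hYint : ∀ i, P[fun ω => g (x i 0 ω)] = f i + (Emus.F μ ψ p grid).mulVec h i := fun i =>
      ((hx i 0).integral_comp hg.aestronglyMeasurable).trans (hg_int i)
    have hYvar : ∀ i, Var[fun ω => g (x i 0 ω); P] = Var[g; Emus.localLaw μ ψ (grid i)] :=
      fun i => by
        rw [← (hx i 0).map_eq, variance_map hg.aemeasurable (hx i 0).aemeasurable]
        rfl
    have key := tendstoInDistribution_sqrt_mul_weighted_means (P := P)
      (Y := fun i n ω => g (x i n ω)) (M := fun k => ∑ i, N k i)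
      (hind.comp (fun _ => g) fun _ => hg)
      (fun i => (hx i 0).map_eq ▸ hg_mem i |>.comp_of_map (hx i 0).aemeasurable)
      (fun i n => ⟨hg.comp_aemeasurable (hx i n).aemeasurable,
        hg.comp_aemeasurable (hx i 0).aemeasurable, (hYlaw i n).trans (hYlaw i 0).symm⟩)
      hNi hw hNw huGrid hlim
    simp only [hYint, hYvar] at key
    refine key.congr_eventually (fun k => ?_) ?_
    · have h1 : ∀ i n, AEMeasurable (fun ω => Emus.ratio ψ p grid l (x i n ω)) P := fun i n =>
        (hmeas l).comp_aemeasurable (hx i n).aemeasurable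
      have h2 := aemeasurable_pi_iff.1 (huGrid k)
      simp only [Emus.uHat, Emus.fHat]
      fun_prop
    · filter_upwards [hsol] with k hk
      filter_upwards [hk] with ω hω
      rw [← huf, Emus.uHat_sub_eq hu hω husum hh]
  · refine le_of_eq_of_le ?_ (Emus.asymptoticVariance_div_le hψ_meas hψ_nonneg hψ_int hz hp_grid
      hp hF hw hmem hf huf (div_nonneg hul.le (Nat.cast_nonneg L)) hh)
    congr 1
    rw [NNReal.coe_sum]
    refine Finset.sum_congr rfl fun i _ => ?_
    rw [NNReal.coe_mul, Real.coe_toNNReal _ (sq_nonneg _), Real.coe_toNNReal _ (variance_nonneg _ _),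
      div_pow, Real.sq_sqrt (hw i).le]
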